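/- Let $n\ge 1$. For $s,\sigma\in\mathbb R$ let $H^s_\sigma=H^s_\sigma(\mathbb R^n)$ be the weighted Sobolev space of tempered distributions $\psi$ on $\mathbb R^n$ with finite norm $$\|\psi\|_{H^s_\sigma}=\|\langle x\rangle^\sigma\langle\nabla\rangle^s\psi\|_{L^2(\mathbb R^n)},\qquad \langle x\rangle=(1+|x|^2)^{1/2},\quad \langle\nabla\rangle=(1-\Delta)^{1/2}.$$ For $\zeta\in\mathbb C\setminus[0,\infty)$ let $R_0(\zeta)=(-\Delta-\zeta)^{-1}$ be the resolvent of the free Schrödinger operator, acting on tempered distributions. Let $k\in\{0,1,2,\dots\}$, $\sigma>\tfrac12+k$, $s\in\mathbb R$, and let $l\in\{-1,0,1,2\}$ if $k=0$, and $l\in\{-1,0,1\}$ if $k\ge1$. Then for every $\zeta\in\mathbb C\setminus[0,\infty)$ the operator $R_0(\zeta)$ restricts to a bounded operator from $H^s_\sigma$ to $H^{s+l}_{-\sigma}$, it is an analytic function of $\zeta\in\mathbb C\setminus[0,\infty)$ with values in the space $\mathcal L(H^s_\sigma,H^{s+l}_{-\sigma})$ of bounded linear operators, with the operator norm, and its $k$-th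 derivative $R_0^{(k)}(\zeta)$ with respect to $\zeta$ satisfies $$\|R_0^{(k)}(\zeta)\|_{\mathcal L(H^s_\sigma,H^{s+l}_{-\sigma})}=\mathcal O\big(|\zeta|^{-\frac{1-l+k}{2}}\big),\qquad |\zeta|\to\infty,\quad \zeta\in\mathbb C\setminus[0,\infty).$$ -/

import Mathlib

open MeasureTheory Filter Topology
open scoped SchwartzMap Real

noncomputable section

namespace WeightedSobolev

/-- Euclidean space `ℝⁿ`. -/
abbrev Rn (n : ℕ) : Type := EuclideanSpace ℝ (Fin n)

/-- Multiplication of tempered distributions by `⟨x⟩^σ`, where `⟨x⟩ = (1 + |x|²)^{1/2}`. -/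
def weight (n : ℕ) (σ : ℝ) : 𝓢'(Rn n, ℂ) →L[ℂ] 𝓢'(Rn n, ℂ) :=
  TemperedDistribution.smulLeftCLM ℂ (fun x : Rn n ↦ (((1 + ‖x‖ ^ 2) ^ (σ / 2) : ℝ) : ℂ))

/-- The operator `⟨∇⟩^s = (1 - Δ)^{s/2}` on tempered distributions. Since the Fourier transform
of Mathlib has the kernel `exp (-2πi x·ξ)`, its symbol is `(1 + |2πξ|²)^{s/2}`. -/
def japaneseNabla (n : ℕ) (s : ℝ) : 𝓢'(Rn n, ℂ) →L[ℂ] 𝓢'(Rn n, ℂ) :=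
  TemperedDistribution.fourierMultiplierCLM ℂ
    (fun ξ : Rn n ↦ (((1 + ‖(2 * π) • ξ‖ ^ 2) ^ (s / 2) : ℝ) : ℂ))

theorem hasTemperateGrowth_weight (n : ℕ) (σ : ℝ) :
    (fun x : Rn n ↦ (((1 + ‖x‖ ^ 2) ^ (σ / 2) : ℝ) : ℂ)).HasTemperateGrowth := by
  fun_prop

theorem hasTemperateGrowth_japanese (n : ℕ) (s : ℝ) :
    (fun ξ : Rn n ↦ (((1 + ‖(2 * π) • ξ‖ ^ 2) ^ (s / 2) : ℝ) : ℂ)).HasTemperateGrowth :=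
  (hasTemperateGrowth_weight n s).comp
    (((2 * π) • ContinuousLinearMap.id ℝ (Rn n)).hasTemperateGrowth)

theorem weight_neg_weight (n : ℕ) (σ : ℝ) (u : 𝓢'(Rn n, ℂ)) :
    weight n (-σ) (weight n σ u) = u := by
  rw [weight, weight, TemperedDistribution.smulLeftCLM_smulLeftCLM_apply
    (hasTemperateGrowth_weight n _) (hasTemperateGrowth_weight n _)]
  convert TemperedDistribution.smulLeftCLM_const (1 : ℂ) u using 2
  · congr 1
    ext x
    simp only [Pi.mul_apply]
    rw [← Complex.ofReal_mul, ← Real.rpow_add (by positivity)]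
    simp [neg_div]
  · simp

theorem japaneseNabla_neg_japaneseNabla (n : ℕ) (s : ℝ) (u : 𝓢'(Rn n, ℂ)) :
    japaneseNabla n (-s) (japaneseNabla n s u) = u := by
  rw [japaneseNabla, japaneseNabla,
    TemperedDistribution.fourierMultiplierCLM_fourierMultiplierCLM_apply
    (hasTemperateGrowth_japanese n _) (hasTemperateGrowth_japanese n _)]
  have h : ((fun ξ : Rn n ↦ (((1 + ‖(2 * π) • ξ‖ ^ 2) ^ (s / 2) : ℝ) : ℂ)) *
      fun ξ : Rn n ↦ (((1 + ‖(2 * π) • ξ‖ ^ 2) ^ (-s / 2) : ℝ) : ℂ)) = fun _ ↦ (1 : ℂ) := by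
    ext x
    simp only [Pi.mul_apply]
    rw [← Complex.ofReal_mul, ← Real.rpow_add (by positivity)]
    simp [neg_div]
  rw [h]
  simp

/-- The weighted Sobolev space `H^s_σ(ℝⁿ)`: the tempered distributions `ψ` for which
`⟨x⟩^σ ⟨∇⟩^s ψ` belongs to `L²(ℝⁿ)`. -/
def Hs (n : ℕ) (s σ : ℝ) : Submodule ℂ 𝓢'(Rn n, ℂ) :=
  Submodule.comap (weight n σ ∘L japaneseNabla n s).toLinearMap
    (LinearMap.range
      (Lp.toTemperedDistributionCLM ℂ (volume : Measure (Rn n)) 2).toLinearMap)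

theorem mem_Hs_iff {n : ℕ} {s σ : ℝ} {ψ : 𝓢'(Rn n, ℂ)} :
    ψ ∈ Hs n s σ ↔ ∃ f : Lp ℂ 2 (volume : Measure (Rn n)),
      Lp.toTemperedDistributionCLM ℂ volume 2 f = weight n σ (japaneseNabla n s ψ) :=
  Iff.rfl

theorem toTempered_injective (n : ℕ) :
    Function.Injective (Lp.toTemperedDistributionCLM ℂ (volume : Measure (Rn n)) 2) :=
  LinearMap.ker_eq_bot.mp Lp.ker_toTemperedDistributionCLM_eq_bot

/-- The space `H^s_σ(ℝⁿ)` as a type of its own: it carries the topology of its norm, and not the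
one that it inherits from the tempered distributions. -/
def H (n : ℕ) (s σ : ℝ) : Type := Hs n s σ

instance (n : ℕ) (s σ : ℝ) : AddCommGroup (H n s σ) :=
  inferInstanceAs (AddCommGroup (Hs n s σ))

instance (n : ℕ) (s σ : ℝ) : Module ℂ (H n s σ) :=
  inferInstanceAs (Module ℂ (Hs n s σ))

/-- The tempered distribution underlying an element of `H^s_σ`. -/
def toDist (n : ℕ) (s σ : ℝ) : H n s σ →ₗ[ℂ] 𝓢'(Rn n, ℂ) := (Hs n s σ).subtype

theorem toDist_injective (n : ℕ) (s σ : ℝ) : Function.Injective (toDist n s σ) :=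
  Subtype.val_injective

/-- The `L²` function `⟨x⟩^σ ⟨∇⟩^s ψ` attached to `ψ ∈ H^s_σ`. -/
def toL2 (n : ℕ) (s σ : ℝ) : H n s σ →ₗ[ℂ] Lp ℂ 2 (volume : Measure (Rn n)) where
  toFun ψ := (mem_Hs_iff.mp ψ.2).choose
  map_add' ψ φ := toTempered_injective n <| by
    rw [map_add, (mem_Hs_iff.mp ψ.2).choose_spec, (mem_Hs_iff.mp φ.2).choose_spec,
      (mem_Hs_iff.mp (ψ + φ).2).choose_spec, ← map_add, ← map_add]
    rfl
  map_smul' c ψ := toTempered_injective n <| by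
    rw [map_smul, (mem_Hs_iff.mp ψ.2).choose_spec, (mem_Hs_iff.mp (c • ψ).2).choose_spec,
      RingHom.id_apply, ← map_smul, ← map_smul]
    rfl

theorem toL2_spec {n : ℕ} {s σ : ℝ} (ψ : H n s σ) :
    Lp.toTemperedDistributionCLM ℂ volume 2 (toL2 n s σ ψ) =
      weight n σ (japaneseNabla n s (toDist n s σ ψ)) :=
  (mem_Hs_iff.mp ψ.2).choose_spec

theorem toL2_injective (n : ℕ) (s σ : ℝ) : Function.Injective (toL2 n s σ) := by
  intro ψ φ h
  have h' := (toL2_spec ψ).symm.trans ((congrArg _ h).trans (toL2_spec φ))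
  apply toDist_injective
  rw [← japaneseNabla_neg_japaneseNabla n s (toDist n s σ ψ),
    ← weight_neg_weight n σ (japaneseNabla n s (toDist n s σ ψ)), h',
    weight_neg_weight, japaneseNabla_neg_japaneseNabla]

/-- The norm `‖ψ‖_{H^s_σ} = ‖⟨x⟩^σ ⟨∇⟩^s ψ‖_{L²}`. -/
instance (n : ℕ) (s σ : ℝ) : NormedAddCommGroup (H n s σ) :=
  NormedAddCommGroup.induced _ _ (toL2 n s σ) (toL2_injective n s σ)

instance (n : ℕ) (s σ : ℝ) : NormedSpace ℂ (H n s σ) :=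
  NormedSpace.induced ℂ _ _ (toL2 n s σ)

theorem norm_def {n : ℕ} {s σ : ℝ} (ψ : H n s σ) : ‖ψ‖ = ‖toL2 n s σ ψ‖ := rfl

/-- The operator `-Δ - ζ` on tempered distributions. -/
def schrodinger (n : ℕ) (ζ : ℂ) : 𝓢'(Rn n, ℂ) →L[ℂ] 𝓢'(Rn n, ℂ) :=
  -LineDeriv.laplacianCLM ℂ (Rn n) 𝓢'(Rn n, ℂ) - ζ • ContinuousLinearMap.id ℂ _

/-- The free resolvent `R₀(ζ) = (-Δ - ζ)⁻¹` on tempered distributions. By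
`schrodinger_freeResolvent` and `freeResolvent_schrodinger` it is the two-sided inverse of
`-Δ - ζ` whenever `ζ` is off the half-line `[0, ∞)`. -/
def freeResolvent (n : ℕ) (ζ : ℂ) : 𝓢'(Rn n, ℂ) →L[ℂ] 𝓢'(Rn n, ℂ) :=
  (schrodinger n ζ).inverse

/-- The slit plane `ℂ \ [0, ∞)`. -/
def slit : Set ℂ := ((fun x : ℝ ↦ (x : ℂ)) '' Set.Ici 0)ᶜ

theorem exists_le_norm_sub {ζ : ℂ} (hζ : ζ ∈ slit) :
    ∃ d : ℝ, 0 < d ∧ ∀ r : ℝ, 0 ≤ r → d < ‖(r : ℂ) - ζ‖ := by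
  have hc : IsClosed ((fun x : ℝ ↦ (x : ℂ)) '' Set.Ici 0) :=
    Complex.isometry_ofReal.isClosedEmbedding.isClosedMap _ isClosed_Ici
  obtain ⟨d, hd, h⟩ := Metric.isOpen_iff.mp hc.isOpen_compl ζ hζ
  refine ⟨d / 2, by positivity, fun r hr ↦ ?_⟩
  by_contra! hlt
  exact h (show (r : ℂ) ∈ Metric.ball ζ d by
    rw [Metric.mem_ball, dist_eq_norm]; linarith) ⟨r, hr, rfl⟩

/-- The symbol `1 / (|2πξ|² - ζ)` of the free resolvent. -/
theorem hasTemperateGrowth_inv_symbol (n : ℕ) {ζ : ℂ} (hζ : ζ ∈ slit) :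
    (fun ξ : Rn n ↦ (((2 * π) ^ 2 * ‖ξ‖ ^ 2 : ℝ) - ζ : ℂ)⁻¹).HasTemperateGrowth := by
  obtain ⟨d, hd, hdist⟩ := exists_le_norm_sub hζ
  have ht : IsOpen {z : ℂ | d < ‖z‖} := isOpen_lt continuous_const continuous_norm
  have hne : ∀ z ∈ {z : ℂ | d < ‖z‖}, z ≠ 0 := fun z hz h ↦ by
    simp only [h, Set.mem_ofPred_eq, norm_zero] at hz
    linarith
  refine Function.HasTemperateGrowth.comp' (g := fun z : ℂ ↦ z⁻¹)
    (f := fun ξ : Rn n ↦ (((2 * π) ^ 2 * ‖ξ‖ ^ 2 : ℝ) - ζ : ℂ)) (t := {z : ℂ | d < ‖z‖})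
    ?_ ht.uniqueDiffOn ?_ ?_ (by fun_prop)
  · rintro - ⟨ξ, rfl⟩
    exact hdist _ (by positivity)
  · exact contDiffOn_id.inv hne
  · intro N
    refine ⟨0, ∑ k ∈ Finset.range (N + 1), (k.factorial : ℝ) * (d ^ (k + 1))⁻¹, by positivity,
      fun k hk z hz ↦ ?_⟩
    have hz0 := hne z hz
    have hcd : ContDiffAt ℂ k (fun z : ℂ ↦ z⁻¹) z := contDiffAt_inv ℂ hz0
    rw [iteratedFDerivWithin_of_isOpen k ht hz, ← hcd.restrictScalars_iteratedFDeriv (𝕜 := ℝ)]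
    simp only [Function.comp_apply, pow_zero, mul_one]
    rw [ContinuousMultilinearMap.norm_restrictScalars, norm_iteratedFDeriv_eq_norm_iteratedDeriv,
      iteratedDeriv_eq_iterate, iter_deriv_inv]
    have hbound : ‖(-1 : ℂ) ^ k * (k.factorial : ℂ) * z ^ (-1 - k : ℤ)‖ ≤
        (k.factorial : ℝ) * (d ^ (k + 1))⁻¹ := by
      have : (-1 - k : ℤ) = -((k + 1 : ℕ) : ℤ) := by push_cast; ring
      rw [this, zpow_neg, zpow_natCast]
      simp only [norm_mul, norm_pow, norm_neg, norm_one, one_pow, one_mul, norm_inv,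
        Complex.norm_natCast]
      gcongr
      exact le_of_lt hz
    refine hbound.trans ?_
    exact Finset.single_le_sum (f := fun k : ℕ ↦ (k.factorial : ℝ) * (d ^ (k + 1))⁻¹)
      (fun _ _ ↦ by positivity) (Finset.mem_range.mpr (by omega))

theorem schrodinger_eq_fourierMultiplier (n : ℕ) (ζ : ℂ) :
    schrodinger n ζ = TemperedDistribution.fourierMultiplierCLM ℂ
      (fun ξ : Rn n ↦ (((2 * π) ^ 2 * ‖ξ‖ ^ 2 : ℝ) - ζ : ℂ)) := by
  have h : (fun ξ : Rn n ↦ (((2 * π) ^ 2 * ‖ξ‖ ^ 2 : ℝ) - ζ : ℂ)) =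
      ((((2 * π) ^ 2 : ℝ) : ℂ) • fun ξ : Rn n ↦ ((‖ξ‖ ^ 2 : ℝ) : ℂ)) - fun _ ↦ ζ := by
    ext ξ
    simp
  ext1 u
  rw [h, TemperedDistribution.fourierMultiplierCLM_apply,
    TemperedDistribution.smulLeftCLM_sub (by fun_prop) (by fun_prop),
    TemperedDistribution.smulLeftCLM_smul (by fun_prop), sub_apply,
    TemperedDistribution.smulLeftCLM_const]
  simp only [schrodinger, sub_apply, neg_apply,
    smul_apply, ContinuousLinearMap.id_apply,
    TemperedDistribution.laplacianCLM_apply,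
    TemperedDistribution.laplacian_eq_fourierMultiplierCLM,
    TemperedDistribution.fourierMultiplierCLM_apply]
  rw [sub_eq_add_neg (_ • _), ← neg_smul ζ, FourierTransform.fourierInv_add,
    FourierTransform.fourierInv_smul,
    FourierTransform.fourierInv_smul, FourierTransform.fourierInv_fourier_eq, neg_smul, neg_neg,
    neg_smul, ← sub_eq_add_neg, Complex.coe_smul]

theorem schrodinger_bijective (n : ℕ) {ζ : ℂ} (hζ : ζ ∈ slit) :
    ∃ e : 𝓢'(Rn n, ℂ) ≃L[ℂ] 𝓢'(Rn n, ℂ), (e : 𝓢'(Rn n, ℂ) →L[ℂ] 𝓢'(Rn n, ℂ)) =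
      schrodinger n ζ := by
  obtain ⟨d, hd, hdist⟩ := exists_le_norm_sub hζ
  have hne : ∀ ξ : Rn n, (((2 * π) ^ 2 * ‖ξ‖ ^ 2 : ℝ) - ζ : ℂ) ≠ 0 := fun ξ ↦
    norm_pos_iff.mp (hd.trans (hdist _ (by positivity)))
  have hsym : (fun ξ : Rn n ↦ (((2 * π) ^ 2 * ‖ξ‖ ^ 2 : ℝ) - ζ : ℂ)).HasTemperateGrowth := by
    fun_prop
  have hone : ((fun ξ : Rn n ↦ (((2 * π) ^ 2 * ‖ξ‖ ^ 2 : ℝ) - ζ : ℂ)) *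
      fun ξ : Rn n ↦ (((2 * π) ^ 2 * ‖ξ‖ ^ 2 : ℝ) - ζ : ℂ)⁻¹) = fun _ ↦ (1 : ℂ) := by
    ext ξ
    exact mul_inv_cancel₀ (hne ξ)
  refine ⟨ContinuousLinearEquiv.equivOfInverse (schrodinger n ζ)
    (TemperedDistribution.fourierMultiplierCLM ℂ
      (fun ξ : Rn n ↦ (((2 * π) ^ 2 * ‖ξ‖ ^ 2 : ℝ) - ζ : ℂ)⁻¹)) (fun u ↦ ?_) (fun u ↦ ?_), rfl⟩
  · rw [schrodinger_eq_fourierMultiplier,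
      TemperedDistribution.fourierMultiplierCLM_fourierMultiplierCLM_apply hsym
        (hasTemperateGrowth_inv_symbol n hζ), hone]
    simp
  · rw [schrodinger_eq_fourierMultiplier,
      TemperedDistribution.fourierMultiplierCLM_fourierMultiplierCLM_apply
        (hasTemperateGrowth_inv_symbol n hζ) hsym, mul_comm, hone]
    simp

theorem schrodinger_freeResolvent (n : ℕ) {ζ : ℂ} (hζ : ζ ∈ slit) (u : 𝓢'(Rn n, ℂ)) :
    schrodinger n ζ (freeResolvent n ζ u) = u := by
  obtain ⟨e, he⟩ := schrodinger_bijective n hζ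
  rw [freeResolvent, ← he, ContinuousLinearMap.inverse_equiv]
  exact e.apply_symm_apply u

theorem freeResolvent_schrodinger (n : ℕ) {ζ : ℂ} (hζ : ζ ∈ slit) (u : 𝓢'(Rn n, ℂ)) :
    freeResolvent n ζ (schrodinger n ζ u) = u := by
  obtain ⟨e, he⟩ := schrodinger_bijective n hζ
  rw [freeResolvent, ← he, ContinuousLinearMap.inverse_equiv]
  exact e.symm_apply_apply u

end WeightedSobolev

end

/-! Conjugating by the isometries `⟨x⟩^σ⟨∇⟩^s` onto L² turns R₀(ζ) into the sandwich `⟨x⟩^{-σ} m(∇)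
⟨x⟩^{-σ}` with symbol m = P^l Q, where P = ⟨2πξ⟩ and Q = 1/(|2πξ|² - ζ). The exponent s disappears,
since Fourier multipliers commute. Off the half-line m is analytic in ζ for the sup norm, and its
k-th derivative is k! Q^k P^l Q. All that remains is to bound these sandwiches as |ζ| → ∞, uniformly
up to the cut.

The analytic core is the case of a single Q, on Schwartz functions and for 1/2 < σ ≤ 1
(`high_energy_estimate`). Write F = (-Δ - ζ)u. Pairing F with ⟨x⟩^{-2σ}u gives an energy estimate
that compares √|ζ| u with ∇u in the weight -σ. Pairing F with an antisymmetric first-order Morawetz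
multiplier controls ∇u in that weight, because the radial field is chosen with a positive definite
derivative. Its error terms either carry the factor |Im ζ|, which the unweighted energy identity
controls, or are small relative to the main terms when |ζ| is large.

Higher powers follow from dilations: with A = x·∇, [A, R^j] = 2j R^j + 2jζ R^{j+1}. Thus R^{j+1} is
ζ^{-1} times a commutator that costs one derivative, of size √|ζ|, and one power of ⟨x⟩, hence the
condition σ > k + 1/2 (`resolventS_pow_estimate`).

The values l ≠ 0 reduce to l = 0 by algebra of symbols. With w² = 1 + ζ and Re w ≥ 0 one has |2πξ|²
- ζ = (P - w)(P + w), and E = 1/(P + w) is O(|ζ|^{-1/2}) in the sup norm. Then PQ = wQ + E, P²Q = 1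
+ (1+ζ)Q and (1+ζ)P⁻¹Q = PQ - P⁻¹. -/

noncomputable section

namespace WeightedSobolev

open scoped LineDeriv

variable {n : ℕ}

/-! ### Weights, partial derivatives and the L² pairing on Schwartz functions -/

/-- The real weight `⟨x⟩^p`. -/
def jap (n : ℕ) (p : ℝ) : Rn n → ℝ := fun x ↦ (1 + ‖x‖ ^ 2) ^ (p / 2)

theorem jap_pos (p : ℝ) (x : Rn n) : 0 < jap n p x := by unfold jap; positivity

theorem jap_add (p q : ℝ) (x : Rn n) : jap n (p + q) x = jap n p x * jap n q x := by
  simp only [jap]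
  rw [← Real.rpow_add (by positivity)]
  ring_nf

theorem jap_zero (x : Rn n) : jap n 0 x = 1 := by simp [jap]

theorem jap_two (x : Rn n) : jap n 2 x = 1 + ‖x‖ ^ 2 := by simp [jap]

theorem jap_mono {p q : ℝ} (h : p ≤ q) (x : Rn n) : jap n p x ≤ jap n q x := by
  unfold jap
  exact Real.rpow_le_rpow_of_exponent_le (by nlinarith [sq_nonneg ‖x‖]) (by linarith)

theorem norm_le_jap_one (x : Rn n) : ‖x‖ ≤ jap n 1 x := by
  refine le_of_sq_le_sq ?_ (jap_pos _ _).le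
  have : jap n 1 x ^ 2 = 1 + ‖x‖ ^ 2 := by rw [sq, ← jap_add, ← jap_two]; norm_num
  linarith

theorem abs_coord_le_jap_one (x : Rn n) (i : Fin n) : |x i| ≤ jap n 1 x :=
  (PiLp.norm_apply_le x i).trans (norm_le_jap_one x)

@[fun_prop]
theorem hasTemperateGrowth_jap (p : ℝ) : (jap n p).HasTemperateGrowth := by
  unfold jap; fun_prop

@[fun_prop]
theorem hasTemperateGrowth_coord (i : Fin n) : (fun x : Rn n ↦ x i).HasTemperateGrowth :=
  (EuclideanSpace.proj (𝕜 := ℝ) i : Rn n →L[ℝ] ℝ).hasTemperateGrowth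

/-- Multiplication of Schwartz functions by a real function of temperate growth. -/
def mulS (g : Rn n → ℝ) : 𝓢(Rn n, ℂ) →L[ℂ] 𝓢(Rn n, ℂ) :=
  SchwartzMap.smulLeftCLM ℂ (fun x ↦ (g x : ℂ))

theorem mulS_apply {g : Rn n → ℝ} (hg : g.HasTemperateGrowth) (u : 𝓢(Rn n, ℂ)) (x : Rn n) :
    mulS g u x = g x * u x := by
  rw [mulS, SchwartzMap.smulLeftCLM_apply_apply (by fun_prop), smul_eq_mul]

/-- The `i`-th partial derivative on Schwartz functions. -/
def dS (i : Fin n) : 𝓢(Rn n, ℂ) →L[ℂ] 𝓢(Rn n, ℂ) :=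
  LineDeriv.lineDerivOpCLM ℂ 𝓢(Rn n, ℂ) (EuclideanSpace.single i (1 : ℝ))

theorem dS_apply (i : Fin n) (u : 𝓢(Rn n, ℂ)) (x : Rn n) :
    dS i u x = fderiv ℝ u x (EuclideanSpace.single i 1) := rfl

theorem dS_comm (i j : Fin n) (u : 𝓢(Rn n, ℂ)) : dS i (dS j u) = dS j (dS i u) := by
  ext x
  have key : ∀ a b : Fin n, dS a (dS b u) x =
      fderiv ℝ (fderiv ℝ u) x (EuclideanSpace.single a 1) (EuclideanSpace.single b 1) := by
    intro a b
    have hd : DifferentiableAt ℝ (fderiv ℝ u) x :=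
      ((u.smooth 2).fderiv_right (m := 1) (by norm_num)).differentiable (by norm_num) x
    have h := hd.hasFDerivAt.clm_apply (hasFDerivAt_const (EuclideanSpace.single b (1 : ℝ)) x)
    rw [dS_apply]
    change fderiv ℝ (fun y ↦ fderiv ℝ u y (EuclideanSpace.single b 1)) x _ = _
    rw [h.fderiv]
    simp
  rw [key, key]
  exact (u.contDiffAt (n := 2)).isSymmSndFDerivAt (by simp) _ _

/-- Leibniz rule. -/
theorem dS_mulS {g g' : Rn n → ℝ} (hg : g.HasTemperateGrowth) (hg' : g'.HasTemperateGrowth)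
    (i : Fin n) (hd : ∀ x, fderiv ℝ g x (EuclideanSpace.single i 1) = g' x) (u : 𝓢(Rn n, ℂ)) :
    dS i (mulS g u) = mulS g' u + mulS g (dS i u) := by
  ext x
  have hgd : HasFDerivAt g (fderiv ℝ g x) x := (hg.1.differentiable (by simp) x).hasFDerivAt
  have h := hgd.smul (u.hasFDerivAt x)
  have he : (mulS g u : Rn n → ℂ) = fun y ↦ g y • u y := by
    ext y; rw [mulS_apply hg]; simp
  rw [dS_apply, he]
  change fderiv ℝ (g • ⇑u) x _ = _
  rw [h.fderiv]
  simp [mulS_apply hg, mulS_apply hg', dS_apply, hd]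
  ring

theorem fderiv_jap (p : ℝ) (i : Fin n) (x : Rn n) :
    fderiv ℝ (jap n p) x (EuclideanSpace.single i 1) = p * (x i * jap n (p - 2) x) := by
  have h1 : HasFDerivAt (fun x : Rn n ↦ 1 + ‖x‖ ^ 2) (2 • innerSL ℝ x) x := by
    simpa using ((hasStrictFDerivAt_norm_sq x).hasFDerivAt.const_add 1)
  have h2 := h1.rpow_const (p := p / 2) (Or.inl (by positivity))
  change fderiv ℝ (fun x : Rn n ↦ (1 + ‖x‖ ^ 2) ^ (p / 2)) x _ = _
  rw [h2.fderiv]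
  simp [jap, EuclideanSpace.inner_single_right]
  ring_nf

theorem fderiv_coord (i j : Fin n) (x : Rn n) :
    fderiv ℝ (fun x : Rn n ↦ x j) x (EuclideanSpace.single i 1) = if i = j then 1 else 0 := by
  have : HasFDerivAt (fun x : Rn n ↦ x j) (EuclideanSpace.proj (𝕜 := ℝ) j : Rn n →L[ℝ] ℝ) x :=
    (EuclideanSpace.proj (𝕜 := ℝ) j : Rn n →L[ℝ] ℝ).hasFDerivAt
  rw [this.fderiv]
  simp [eq_comm]

/-- The inclusion of the Schwartz functions into `L²`. -/
def toL (n : ℕ) : 𝓢(Rn n, ℂ) →L[ℂ] Lp ℂ 2 (volume : Measure (Rn n)) :=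
  SchwartzMap.toLpCLM ℂ ℂ 2 volume

/-- The `L²` inner product of Schwartz functions. -/
def ip (u v : 𝓢(Rn n, ℂ)) : ℂ := inner ℂ (toL n u) (toL n v)

theorem ip_eq_integral (u v : 𝓢(Rn n, ℂ)) : ip u v = ∫ x, inner ℂ (u x) (v x) :=
  SchwartzMap.inner_toL2_toL2_eq u v volume

theorem ip_add_left (u v w : 𝓢(Rn n, ℂ)) : ip (u + v) w = ip u w + ip v w := by
  simp only [ip, map_add, inner_add_left]

theorem ip_add_right (u v w : 𝓢(Rn n, ℂ)) : ip u (v + w) = ip u v + ip u w := by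
  simp only [ip, map_add, inner_add_right]

theorem ip_smul_left (c : ℂ) (u v : 𝓢(Rn n, ℂ)) : ip (c • u) v = starRingEnd ℂ c * ip u v := by
  simp only [ip, map_smul, inner_smul_left]

theorem ip_smul_right (c : ℂ) (u v : 𝓢(Rn n, ℂ)) : ip u (c • v) = c * ip u v := by
  simp only [ip, map_smul, inner_smul_right]

theorem ip_neg_right (u v : 𝓢(Rn n, ℂ)) : ip u (-v) = -ip u v := by
  simp only [ip, map_neg, inner_neg_right]

theorem ip_sub_right (u v w : 𝓢(Rn n, ℂ)) : ip u (v - w) = ip u v - ip u w := by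
  simp only [ip, map_sub, inner_sub_right]

theorem ip_sum_left {ι : Type*} (s : Finset ι) (u : ι → 𝓢(Rn n, ℂ)) (v : 𝓢(Rn n, ℂ)) :
    ip (∑ i ∈ s, u i) v = ∑ i ∈ s, ip (u i) v := by
  simp only [ip, map_sum, sum_inner]

theorem ip_sum_right {ι : Type*} (s : Finset ι) (u : 𝓢(Rn n, ℂ)) (v : ι → 𝓢(Rn n, ℂ)) :
    ip u (∑ i ∈ s, v i) = ∑ i ∈ s, ip u (v i) := by
  simp only [ip, map_sum, inner_sum]

theorem conj_ip (u v : 𝓢(Rn n, ℂ)) : starRingEnd ℂ (ip u v) = ip v u := inner_conj_symm _ _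

theorem re_ip_symm (u v : 𝓢(Rn n, ℂ)) : (ip u v).re = (ip v u).re := by
  rw [← conj_ip, Complex.conj_re]

theorem ip_mulS {g : Rn n → ℝ} (hg : g.HasTemperateGrowth) (u v : 𝓢(Rn n, ℂ)) :
    ip (mulS g u) v = ip u (mulS g v) := by
  simp only [ip_eq_integral, mulS_apply hg]
  refine integral_congr_ae (.of_forall fun x ↦ ?_)
  simp
  ring

theorem ip_dS (i : Fin n) (u v : 𝓢(Rn n, ℂ)) : ip (dS i u) v = -ip u (dS i v) := by
  simp only [ip_eq_integral]
  have h := SchwartzMap.integral_bilinear_lineDerivOp_right_eq_neg_left (μ := volume) u v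
    ((ContinuousLinearMap.mul ℝ ℂ).comp (Complex.conjCLE : ℂ →L[ℝ] ℂ))
      (EuclideanSpace.single i (1 : ℝ))
  have e : ∀ a b : ℂ, inner ℂ a b = ((ContinuousLinearMap.mul ℝ ℂ).comp
      (Complex.conjCLE : ℂ →L[ℝ] ℂ)) a b := by
    intro a b; simp [mul_comm]
  simp only [e]
  exact (neg_eq_iff_eq_neg.mpr h).symm

theorem norm_toL_le {u v : 𝓢(Rn n, ℂ)} {C : ℝ} (h : ∀ x, ‖u x‖ ≤ C * ‖v x‖) :
    ‖toL n u‖ ≤ C * ‖toL n v‖ := by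
  refine Lp.norm_le_mul_norm_of_ae_le_mul ?_
  filter_upwards [u.coeFn_toLp 2 volume, v.coeFn_toLp 2 volume] with x hu hv
  change ‖(u.toLp 2 volume : Rn n → ℂ) x‖ ≤ C * ‖(v.toLp 2 volume : Rn n → ℂ) x‖
  rw [hu, hv]
  exact h x

/-- The weighted norm `‖⟨x⟩^p u‖` in `L²`. -/
def wnorm (p : ℝ) (u : 𝓢(Rn n, ℂ)) : ℝ := ‖toL n (mulS (jap n p) u)‖

theorem wnorm_nonneg (p : ℝ) (u : 𝓢(Rn n, ℂ)) : 0 ≤ wnorm p u := norm_nonneg _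

theorem wnorm_sub_le (p : ℝ) (u v : 𝓢(Rn n, ℂ)) : wnorm p (u - v) ≤ wnorm p u + wnorm p v := by
  simpa only [wnorm, map_sub] using norm_sub_le _ _

theorem wnorm_smul (p : ℝ) (c : ℂ) (u : 𝓢(Rn n, ℂ)) : wnorm p (c • u) = ‖c‖ * wnorm p u := by
  simp only [wnorm, map_smul, norm_smul]

theorem wnorm_sum_le {ι : Type*} (s : Finset ι) (p : ℝ) (u : ι → 𝓢(Rn n, ℂ)) :
    wnorm p (∑ i ∈ s, u i) ≤ ∑ i ∈ s, wnorm p (u i) := by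
  simpa only [wnorm, map_sum] using norm_sum_le _ _

theorem wnorm_mulS_le {g : Rn n → ℝ} (hg : g.HasTemperateGrowth) {p q C : ℝ}
    (h : ∀ x, |g x| ≤ C * jap n (q - p) x) (u : 𝓢(Rn n, ℂ)) :
    wnorm p (mulS g u) ≤ C * wnorm q u := by
  refine norm_toL_le fun x ↦ ?_
  rw [mulS_apply (by fun_prop), mulS_apply hg, mulS_apply (by fun_prop)]
  simp only [norm_mul, Complex.norm_real, Real.norm_eq_abs, abs_of_pos (jap_pos _ x)]
  calc jap n p x * (|g x| * ‖u x‖) ≤ jap n p x * (C * jap n (q - p) x * ‖u x‖) := by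
        gcongr
        exacts [(jap_pos _ _).le, h x]
    _ = C * (jap n (p + (q - p)) x * ‖u x‖) := by rw [jap_add]; ring
    _ = _ := by rw [add_sub_cancel]

theorem mulS_mulS {g h : Rn n → ℝ} (hg : g.HasTemperateGrowth) (hh : h.HasTemperateGrowth)
    (u : 𝓢(Rn n, ℂ)) : mulS g (mulS h u) = mulS (fun x ↦ g x * h x) u := by
  ext x
  rw [mulS_apply hg, mulS_apply hh, mulS_apply (by fun_prop)]
  push_cast
  ring

theorem mulS_one (u : 𝓢(Rn n, ℂ)) : mulS (fun _ ↦ 1) u = u := by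
  ext x
  rw [mulS_apply (by fun_prop)]
  simp

theorem mulS_jap_zero (u : 𝓢(Rn n, ℂ)) : mulS (jap n 0) u = u := by
  rw [show jap n 0 = fun _ ↦ 1 from funext jap_zero, mulS_one]

theorem mulS_jap_mulS_jap (p q : ℝ) (u : 𝓢(Rn n, ℂ)) :
    mulS (jap n p) (mulS (jap n q) u) = mulS (jap n (p + q)) u := by
  rw [mulS_mulS (by fun_prop) (by fun_prop), show jap n (p + q) = _ from funext (jap_add p q)]

theorem wnorm_mono {p q : ℝ} (h : p ≤ q) (u : 𝓢(Rn n, ℂ)) : wnorm p u ≤ wnorm q u := by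
  have := wnorm_mulS_le (g := fun _ ↦ 1) (p := p) (q := q) (C := 1) (by fun_prop)
    (fun x ↦ by simpa [jap_zero] using jap_mono (sub_nonneg.mpr h) x) u
  simpa [mulS_one] using this

/-- Cauchy–Schwarz after inserting ⟨x⟩^{-q}⟨x⟩^q = 1 in front of v and moving the factor ⟨x⟩^{-q} to
the other side. Every error term below is estimated in this way, so only pointwise bounds on
coefficients are needed. -/
theorem norm_ip_mulS_le {g : Rn n → ℝ} (hg : g.HasTemperateGrowth) {p q C : ℝ}
    (h : ∀ x, |g x| ≤ C * jap n (p + q) x) (u v : 𝓢(Rn n, ℂ)) :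
    ‖ip (mulS g u) v‖ ≤ C * (wnorm p u * wnorm q v) := by
  have hv : v = mulS (jap n (-q)) (mulS (jap n q) v) := by
    rw [mulS_jap_mulS_jap, neg_add_cancel, mulS_jap_zero]
  rw [hv, ← ip_mulS (by fun_prop), ← hv, ← mul_assoc]
  refine (norm_inner_le_norm _ _).trans ?_
  refine mul_le_mul_of_nonneg_right ?_ (norm_nonneg _)
  exact wnorm_mulS_le hg (p := -q) (q := p) (fun x ↦ by simpa using h x) u

theorem norm_ip_le (p : ℝ) (u v : 𝓢(Rn n, ℂ)) : ‖ip u v‖ ≤ wnorm (-p) u * wnorm p v := by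
  have := norm_ip_mulS_le (g := fun _ ↦ 1) (p := -p) (q := p) (C := 1) (by fun_prop)
    (fun x ↦ by simp [jap_zero]) u v
  simpa [mulS_one] using this

theorem ip_self (u : 𝓢(Rn n, ℂ)) : ip u u = (wnorm 0 u ^ 2 : ℝ) := by
  rw [ip, inner_self_eq_norm_sq_to_K, wnorm, mulS_jap_zero]
  norm_cast

theorem ip_mulS_jap_self (p : ℝ) (u : 𝓢(Rn n, ℂ)) :
    ip (mulS (jap n (2 * p)) u) u = (wnorm p u ^ 2 : ℝ) := by
  rw [two_mul, ← mulS_jap_mulS_jap, ip_mulS (by fun_prop), ip, inner_self_eq_norm_sq_to_K, wnorm]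
  norm_cast

/-! ### The Schrödinger and Euler operators on Schwartz functions -/

/-- The operator `-Δ - ζ` on Schwartz functions. -/
def schrodingerS (n : ℕ) (ζ : ℂ) : 𝓢(Rn n, ℂ) →L[ℂ] 𝓢(Rn n, ℂ) :=
  -(∑ i, dS i ∘L dS i) - ζ • ContinuousLinearMap.id ℂ _

theorem schrodingerS_apply (ζ : ℂ) (u : 𝓢(Rn n, ℂ)) :
    schrodingerS n ζ u = -(∑ i, dS i (dS i u)) - ζ • u := by
  simp [schrodingerS]

theorem ip_schrodingerS (ζ : ℂ) (u v : 𝓢(Rn n, ℂ)) :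
    ip v (schrodingerS n ζ u) = ∑ i, ip (dS i v) (dS i u) - ζ * ip v u := by
  rw [schrodingerS_apply, ip_sub_right, ip_neg_right, ip_sum_right, ip_smul_right]
  simp only [ip_dS, Finset.sum_neg_distrib]

/-- The Euler operator `∑ xⱼ ∂ⱼ`. -/
def euler (n : ℕ) : 𝓢(Rn n, ℂ) →L[ℂ] 𝓢(Rn n, ℂ) := ∑ j, mulS (fun x ↦ x j) ∘L dS j

theorem euler_eq (u : 𝓢(Rn n, ℂ)) : euler n u = ∑ j, mulS (fun x ↦ x j) (dS j u) := by
  simp [euler]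

theorem dS_coord (i j : Fin n) (u : 𝓢(Rn n, ℂ)) :
    dS i (mulS (fun x ↦ x j) u) = (if i = j then u else 0) + mulS (fun x ↦ x j) (dS i u) := by
  rw [dS_mulS (g' := fun _ ↦ if i = j then 1 else 0) (by fun_prop) (by fun_prop) i
    (fderiv_coord i j)]
  split_ifs with h
  · rw [mulS_one]
  · congr 1
    ext x
    rw [mulS_apply (by fun_prop)]
    simp

theorem dS_euler (i : Fin n) (u : 𝓢(Rn n, ℂ)) :
    dS i (euler n u) = euler n (dS i u) + dS i u := by
  simp only [euler_eq, map_sum, dS_coord, Finset.sum_add_distrib]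
  rw [add_comm]
  congr 1
  · exact Finset.sum_congr rfl fun j _ ↦ by rw [dS_comm]
  · simp

end WeightedSobolev
end

noncomputable section

namespace WeightedSobolev

variable {n : ℕ}

/-! ### Weighted energy estimate and Morawetz multiplier -/

/-- The energy identity with the weight `⟨x⟩^{-2σ}`, as an estimate. -/
theorem weighted_energy {σ : ℝ} (hσ : 0 ≤ σ) (ζ : ℂ) (u : 𝓢(Rn n, ℂ)) :
    ‖((∑ i, wnorm (-σ) (dS i u) ^ 2 : ℝ) : ℂ) - ζ * (wnorm (-σ) u ^ 2 : ℝ)‖ ≤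
      2 * σ * (wnorm (-σ) u * ∑ i, wnorm (-σ) (dS i u)) +
        wnorm (-σ) u * wnorm (-σ) (schrodingerS n ζ u) := by
  have hid := ip_schrodingerS ζ u (mulS (jap n (2 * -σ)) u)
  have hd : ∀ i, dS i (mulS (jap n (2 * -σ)) u) =
      mulS (fun x ↦ 2 * -σ * (x i * jap n (2 * -σ - 2) x)) u + mulS (jap n (2 * -σ)) (dS i u) :=
    fun i ↦ dS_mulS (by fun_prop) (by fun_prop) i (fderiv_jap _ i) u
  simp only [hd, ip_add_left, Finset.sum_add_distrib, ip_mulS_jap_self] at hid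
  -- The derivative that falls on the weight loses nothing: |x_i|⟨x⟩^{-2σ-2} ≤ ⟨x⟩^{-2σ}.
  have hb : ∀ i, ‖ip (mulS (fun x ↦ 2 * -σ * (x i * jap n (2 * -σ - 2) x)) u) (dS i u)‖ ≤
      2 * σ * (wnorm (-σ) u * wnorm (-σ) (dS i u)) := by
    intro i
    refine norm_ip_mulS_le (by fun_prop) (fun x ↦ ?_) _ _
    rw [abs_mul (2 * -σ), abs_mul (x i), abs_of_pos (jap_pos _ x),
      abs_of_nonpos (by linarith : 2 * -σ ≤ 0)]
    have h1 : |x i| * jap n (2 * -σ - 2) x ≤ jap n (-σ + -σ) x := by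
      calc |x i| * jap n (2 * -σ - 2) x ≤ jap n 1 x * jap n (2 * -σ - 2) x := by
            gcongr
            exacts [(jap_pos _ _).le, abs_coord_le_jap_one x i]
        _ = jap n (1 + (2 * -σ - 2)) x := (jap_add _ _ _).symm
        _ ≤ _ := jap_mono (by linarith) x
    nlinarith
  have hF : ‖ip (mulS (jap n (2 * -σ)) u) (schrodingerS n ζ u)‖ ≤
      wnorm (-σ) u * wnorm (-σ) (schrodingerS n ζ u) := by
    rw [← one_mul (wnorm (-σ) u * _)]
    exact norm_ip_mulS_le (by fun_prop) (fun x ↦ by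
      rw [abs_of_pos (jap_pos _ x), two_mul, one_mul]) _ _
  have heq : ((∑ i, wnorm (-σ) (dS i u) ^ 2 : ℝ) : ℂ) - ζ * (wnorm (-σ) u ^ 2 : ℝ) =
      ip (mulS (jap n (2 * -σ)) u) (schrodingerS n ζ u) -
        ∑ i, ip (mulS (fun x ↦ 2 * -σ * (x i * jap n (2 * -σ - 2) x)) u) (dS i u) := by
    rw [hid, Complex.ofReal_sum]
    ring
  rw [heq]
  refine (norm_sub_le _ _).trans ?_
  have hs := (norm_sum_le Finset.univ fun i ↦
    ip (mulS (fun x ↦ 2 * -σ * (x i * jap n (2 * -σ - 2) x)) u) (dS i u)).trans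
    (Finset.sum_le_sum fun i _ ↦ hb i)
  rw [← Finset.mul_sum, ← Finset.mul_sum] at hs
  linarith

/-- The radial profile `g` of the Morawetz vector field `x g(x)`. -/
def morawetzG (n : ℕ) (δ : ℝ) : Rn n → ℝ := fun x ↦ 2 * jap n (-1) x - jap n (-1 - δ) x

/-- The function `h` with `∂ᵢ g = xᵢ h`. -/
def morawetzH (n : ℕ) (δ : ℝ) : Rn n → ℝ :=
  fun x ↦ -2 * jap n (-3) x + (1 + δ) * jap n (-3 - δ) x

/-- The function `k` with `∂ᵢ h = xᵢ k`. -/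
def morawetzK (n : ℕ) (δ : ℝ) : Rn n → ℝ :=
  fun x ↦ 6 * jap n (-5) x - (1 + δ) * (3 + δ) * jap n (-5 - δ) x

/-- The divergence of the Morawetz vector field. -/
def morawetzB (n : ℕ) (δ : ℝ) : Rn n → ℝ :=
  fun x ↦ n * morawetzG n δ x + ‖x‖ ^ 2 * morawetzH n δ x

/-- The function `c` with `∂ᵢ b = xᵢ c`, where `b` is the divergence of the Morawetz vector
field. -/
def morawetzC (n : ℕ) (δ : ℝ) : Rn n → ℝ :=
  fun x ↦ (n + 2) * morawetzH n δ x + ‖x‖ ^ 2 * morawetzK n δ x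

@[fun_prop]
theorem hasTemperateGrowth_morawetzG (δ : ℝ) : (morawetzG n δ).HasTemperateGrowth := by
  unfold morawetzG; fun_prop

@[fun_prop]
theorem hasTemperateGrowth_morawetzH (δ : ℝ) : (morawetzH n δ).HasTemperateGrowth := by
  unfold morawetzH; fun_prop

@[fun_prop]
theorem hasTemperateGrowth_morawetzK (δ : ℝ) : (morawetzK n δ).HasTemperateGrowth := by
  unfold morawetzK; fun_prop

@[fun_prop]
theorem hasTemperateGrowth_morawetzB (δ : ℝ) : (morawetzB n δ).HasTemperateGrowth := by
  unfold morawetzB; fun_prop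

@[fun_prop]
theorem hasTemperateGrowth_morawetzC (δ : ℝ) : (morawetzC n δ).HasTemperateGrowth := by
  unfold morawetzC; fun_prop

theorem differentiableAt_of_hasTemperateGrowth {g : Rn n → ℝ} (hg : g.HasTemperateGrowth)
    (x : Rn n) : DifferentiableAt ℝ g x := hg.1.differentiable (by simp) x

theorem fderiv_lincomb {g h : Rn n → ℝ} (hg : g.HasTemperateGrowth) (hh : h.HasTemperateGrowth)
    (a b : ℝ) (x v : Rn n) :
    fderiv ℝ (fun x ↦ a * g x + b * h x) x v = a * fderiv ℝ g x v + b * fderiv ℝ h x v := by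
  have h1 := (differentiableAt_of_hasTemperateGrowth hg x).hasFDerivAt.const_mul a
  have h2 := (differentiableAt_of_hasTemperateGrowth hh x).hasFDerivAt.const_mul b
  rw [(h1.fun_add h2).fderiv]
  simp

theorem fderiv_morawetzG (δ : ℝ) (i : Fin n) (x : Rn n) :
    fderiv ℝ (morawetzG n δ) x (EuclideanSpace.single i 1) = x i * morawetzH n δ x := by
  have h := fderiv_lincomb (hasTemperateGrowth_jap (n := n) (-1))
    (hasTemperateGrowth_jap (n := n) (-1 - δ)) 2 (-1) x (EuclideanSpace.single i 1)
  have e : morawetzG n δ = fun x ↦ 2 * jap n (-1) x + (-1) * jap n (-1 - δ) x := by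
    ext y; simp only [morawetzG]; ring
  rw [e, h, fderiv_jap, fderiv_jap, morawetzH]
  ring_nf

theorem fderiv_morawetzH (δ : ℝ) (i : Fin n) (x : Rn n) :
    fderiv ℝ (morawetzH n δ) x (EuclideanSpace.single i 1) = x i * morawetzK n δ x := by
  have h := fderiv_lincomb (hasTemperateGrowth_jap (n := n) (-3))
    (hasTemperateGrowth_jap (n := n) (-3 - δ)) (-2) (1 + δ) x (EuclideanSpace.single i 1)
  change fderiv ℝ (fun x ↦ -2 * jap n (-3) x + (1 + δ) * jap n (-3 - δ) x) x _ = _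
  rw [h, fderiv_jap, fderiv_jap, morawetzK]
  ring_nf

theorem fderiv_morawetzB (δ : ℝ) (i : Fin n) (x : Rn n) :
    fderiv ℝ (morawetzB n δ) x (EuclideanSpace.single i 1) = x i * morawetzC n δ x := by
  have h1 := (differentiableAt_of_hasTemperateGrowth
    (hasTemperateGrowth_morawetzG δ) x).hasFDerivAt.const_mul (n : ℝ)
  have h2 := (hasStrictFDerivAt_norm_sq x).hasFDerivAt.mul (differentiableAt_of_hasTemperateGrowth
    (hasTemperateGrowth_morawetzH δ) x).hasFDerivAt
  have h3 := h1.add h2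
  change fderiv ℝ ((fun x ↦ (n : ℝ) * morawetzG n δ x) +
    ((fun x ↦ ‖x‖ ^ 2) * morawetzH n δ)) x _ = _
  rw [h3.fderiv]
  simp [fderiv_morawetzG, fderiv_morawetzH, morawetzC, EuclideanSpace.inner_single_right]
  ring

theorem morawetzG_mem {δ : ℝ} (hδ : 0 ≤ δ) (x : Rn n) :
    jap n (-1) x ≤ morawetzG n δ x ∧ morawetzG n δ x ≤ 2 * jap n (-1) x := by
  have h1 := jap_mono (by linarith : -1 - δ ≤ -1) x
  have h2 := jap_pos (-1 - δ) x
  constructor <;> simp only [morawetzG] <;> linarith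

theorem morawetzH_mem {δ : ℝ} (hδ : 0 ≤ δ) (hδ1 : δ ≤ 1) (x : Rn n) :
    -(2 * jap n (-3) x) ≤ morawetzH n δ x ∧ morawetzH n δ x ≤ 0 := by
  have h1 := jap_mono (by linarith : -3 - δ ≤ -3) x
  have h2 := jap_pos (-3 - δ) x
  constructor <;> simp only [morawetzH] <;> nlinarith

theorem abs_morawetzK_le {δ : ℝ} (hδ : 0 ≤ δ) (hδ1 : δ ≤ 1) (x : Rn n) :
    |morawetzK n δ x| ≤ 8 * jap n (-5) x := by
  have h1 := jap_mono (by linarith : -5 - δ ≤ -5) x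
  have h2 := jap_pos (-5 - δ) x
  have h3 : (1 + δ) * (3 + δ) ≤ 8 := by nlinarith
  have h4 : 0 ≤ (1 + δ) * (3 + δ) := by positivity
  rw [abs_le]
  constructor <;> simp only [morawetzK] <;> nlinarith

theorem norm_sq_le_jap_two (x : Rn n) : ‖x‖ ^ 2 ≤ jap n 2 x := by rw [jap_two]; linarith

theorem abs_morawetzB_le {δ : ℝ} (hδ : 0 ≤ δ) (hδ1 : δ ≤ 1) (x : Rn n) :
    |morawetzB n δ x| ≤ (2 * n + 2) * jap n (-1) x := by
  obtain ⟨h1, h2⟩ := morawetzG_mem hδ x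
  obtain ⟨h3, h4⟩ := morawetzH_mem hδ hδ1 x
  have h5 : |‖x‖ ^ 2 * morawetzH n δ x| ≤ 2 * jap n (-1) x := by
    rw [abs_mul, abs_of_nonneg (by positivity : (0 : ℝ) ≤ ‖x‖ ^ 2), abs_of_nonpos h4]
    calc ‖x‖ ^ 2 * -morawetzH n δ x ≤ jap n 2 x * (2 * jap n (-3) x) := by
          gcongr
          exacts [by linarith, (jap_pos _ _).le, norm_sq_le_jap_two x, by linarith]
      _ = 2 * jap n (2 + -3) x := by rw [jap_add]; ring
      _ = _ := by norm_num
  have h6 : |(n : ℝ) * morawetzG n δ x| ≤ 2 * n * jap n (-1) x := by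
    have := jap_pos (-1) x
    rw [abs_mul, Nat.abs_cast, abs_of_pos (by linarith)]
    nlinarith [(Nat.cast_nonneg n : (0 : ℝ) ≤ n)]
  rw [morawetzB]
  refine (abs_add_le _ _).trans ?_
  linarith

theorem abs_coord_mul_morawetzC_le {δ : ℝ} (hδ : 0 ≤ δ) (hδ1 : δ ≤ 1) (i : Fin n) (x : Rn n) :
    |x i * morawetzC n δ x| ≤ (2 * n + 12) * jap n (-2) x := by
  obtain ⟨h3, h4⟩ := morawetzH_mem hδ hδ1 x
  have h5 : |‖x‖ ^ 2 * morawetzK n δ x| ≤ 8 * jap n (-3) x := by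
    rw [abs_mul, abs_of_nonneg (by positivity : (0 : ℝ) ≤ ‖x‖ ^ 2)]
    calc ‖x‖ ^ 2 * |morawetzK n δ x| ≤ jap n 2 x * (8 * jap n (-5) x) := by
          gcongr
          exacts [(jap_pos _ _).le, norm_sq_le_jap_two x, abs_morawetzK_le hδ hδ1 x]
      _ = 8 * jap n (2 + -5) x := by rw [jap_add]; ring
      _ = _ := by norm_num
  have h6 : |(n + 2 : ℝ) * morawetzH n δ x| ≤ (2 * n + 4) * jap n (-3) x := by
    rw [abs_mul, abs_of_nonneg (by positivity : (0 : ℝ) ≤ n + 2), abs_of_nonpos h4]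
    nlinarith [(Nat.cast_nonneg n : (0 : ℝ) ≤ n)]
  have h7 : |morawetzC n δ x| ≤ (2 * n + 12) * jap n (-3) x := by
    rw [morawetzC]
    refine (abs_add_le _ _).trans ?_
    linarith
  calc |x i * morawetzC n δ x| ≤ jap n 1 x * ((2 * n + 12) * jap n (-3) x) := by
        rw [abs_mul]
        gcongr
        exacts [(jap_pos _ _).le, abs_coord_le_jap_one x i]
    _ = (2 * n + 12) * jap n (1 + -3) x := by rw [jap_add]; ring
    _ = _ := by norm_num

/-- The antisymmetric Morawetz multiplier `2 g x·∇ + div (g x)`. -/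
def morawetz (n : ℕ) (δ : ℝ) : 𝓢(Rn n, ℂ) →L[ℂ] 𝓢(Rn n, ℂ) :=
  (2 : ℂ) • (mulS (morawetzG n δ) ∘L euler n) + mulS (morawetzB n δ)

theorem morawetz_apply (δ : ℝ) (u : 𝓢(Rn n, ℂ)) :
    morawetz n δ u = (2 : ℂ) • mulS (morawetzG n δ) (euler n u) + mulS (morawetzB n δ) u := by
  simp [morawetz]

/-- The commutator of ∂ᵢ with the multiplier. Its two first-order terms form the quadratic form of
`morawetz_coercive`; the zeroth-order term has a coefficient that is O(⟨x⟩^{-2}). -/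
theorem dS_morawetz (δ : ℝ) (i : Fin n) (u : 𝓢(Rn n, ℂ)) :
    dS i (morawetz n δ u) = morawetz n δ (dS i u) +
      ((2 : ℂ) • mulS (fun x ↦ x i) (mulS (morawetzH n δ) (euler n u)) +
        ((2 : ℂ) • mulS (morawetzG n δ) (dS i u) +
          mulS (fun x ↦ x i * morawetzC n δ x) u)) := by
  simp only [morawetz_apply, map_add, map_smul]
  rw [dS_mulS (by fun_prop) (by fun_prop) i (fderiv_morawetzG δ i),
    dS_mulS (by fun_prop) (by fun_prop) i (fderiv_morawetzB δ i), dS_euler, map_add,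
    mulS_mulS (by fun_prop) (by fun_prop)]
  simp only [smul_add]
  abel

theorem norm_sq_eq_sum_sq (x : Rn n) : ‖x‖ ^ 2 = ∑ j, x j * x j := by
  rw [EuclideanSpace.norm_sq_eq]
  exact Finset.sum_congr rfl fun j _ ↦ by rw [Real.norm_eq_abs, sq_abs, sq]

theorem mulS_comm {g h : Rn n → ℝ} (hg : g.HasTemperateGrowth) (hh : h.HasTemperateGrowth)
    (u : 𝓢(Rn n, ℂ)) : mulS g (mulS h u) = mulS h (mulS g u) := by
  rw [mulS_mulS hg hh, mulS_mulS hh hg]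
  simp only [mul_comm]

/-- The multiplier is X·∇ + ∇·X for the real field X = x g, and integration by parts makes such an
operator antisymmetric. -/
theorem re_ip_morawetz (δ : ℝ) (v : 𝓢(Rn n, ℂ)) : (ip (morawetz n δ v) v).re = 0 := by
  have h1 : ip (mulS (morawetzG n δ) (euler n v)) v =
      -ip v (mulS (morawetzB n δ) v + mulS (morawetzG n δ) (euler n v)) := by
    have hsum : mulS (morawetzB n δ) v + mulS (morawetzG n δ) (euler n v) =
        ∑ j, dS j (mulS (fun x ↦ x j) (mulS (morawetzG n δ) v)) := by
      have hj : ∀ j, dS j (mulS (fun x ↦ x j) (mulS (morawetzG n δ) v)) =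
          (mulS (morawetzG n δ) v + mulS (fun x ↦ x j * (x j * morawetzH n δ x)) v) +
            mulS (morawetzG n δ) (mulS (fun x ↦ x j) (dS j v)) := by
        intro j
        rw [dS_coord, if_pos rfl, dS_mulS (by fun_prop) (by fun_prop) j (fderiv_morawetzG δ j),
          map_add, mulS_mulS (by fun_prop) (by fun_prop), mulS_comm (by fun_prop) (by fun_prop)]
        abel
      simp only [hj, Finset.sum_add_distrib]
      rw [euler_eq, map_sum]
      congr 1
      ext x
      simp only [add_apply, sum_apply, mulS_apply (hasTemperateGrowth_morawetzB (n := n) δ),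
        Finset.sum_const]
      have hx : ∀ j, mulS (fun x ↦ x j * (x j * morawetzH n δ x)) v x =
          ((x j * x j : ℝ) : ℂ) * (morawetzH n δ x * v x) := by
        intro j
        rw [mulS_apply (by fun_prop)]
        push_cast
        ring
      simp only [hx, ← Finset.sum_mul, ← Complex.ofReal_sum, ← norm_sq_eq_sum_sq, morawetzB]
      simp [mulS_apply (hasTemperateGrowth_morawetzG (n := n) δ)]
      ring
    rw [hsum, ip_sum_right, euler_eq, map_sum, ip_sum_left, ← Finset.sum_neg_distrib]
    refine Finset.sum_congr rfl fun j _ ↦ ?_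
    rw [ip_mulS (by fun_prop), ip_mulS (by fun_prop), ip_dS]
  have h2 := congrArg Complex.re h1
  rw [ip_add_right] at h2
  simp only [Complex.neg_re, Complex.add_re] at h2
  rw [re_ip_symm v (mulS (morawetzG n δ) (euler n v)), re_ip_symm v (mulS _ v)] at h2
  rw [morawetz_apply, ip_add_left, ip_smul_left, Complex.add_re, map_ofNat]
  simp only [Complex.mul_re, Complex.re_ofNat, Complex.im_ofNat, zero_mul, sub_zero]
  linarith

/-- The field x g is bounded and so is its divergence, hence the multiplier costs no weight. It is
applied with p = σ against F, and with p = 0 against u. -/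
theorem norm_ip_morawetz_le {δ : ℝ} (hδ : 0 ≤ δ) (hδ1 : δ ≤ 1) (p : ℝ) (u v : 𝓢(Rn n, ℂ)) :
    ‖ip (morawetz n δ u) v‖ ≤
      (4 * ∑ j, wnorm (-p) (dS j u) + (2 * n + 2) * wnorm (-p) u) * wnorm p v := by
  have h1 : ∀ j, ‖ip (mulS (morawetzG n δ) (mulS (fun x ↦ x j) (dS j u))) v‖ ≤
      2 * (wnorm (-p) (dS j u) * wnorm p v) := by
    intro j
    rw [mulS_mulS (by fun_prop) (by fun_prop)]
    refine norm_ip_mulS_le (by fun_prop) (fun x ↦ ?_) _ _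
    obtain ⟨h1, h2⟩ := morawetzG_mem hδ x
    rw [neg_add_cancel, abs_mul, abs_of_pos (lt_of_lt_of_le (jap_pos _ _) h1)]
    calc morawetzG n δ x * |x j| ≤ 2 * jap n (-1) x * jap n 1 x := by
          gcongr
          exacts [by linarith [jap_pos (-1) x], abs_coord_le_jap_one x j]
      _ = 2 * jap n (-1 + 1) x := by rw [jap_add]; ring
      _ = _ := by norm_num
  have h2 : ‖ip (mulS (morawetzB n δ) u) v‖ ≤ (2 * n + 2) * (wnorm (-p) u * wnorm p v) := by
    refine norm_ip_mulS_le (by fun_prop) (fun x ↦ ?_) _ _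
    refine (abs_morawetzB_le hδ hδ1 x).trans ?_
    gcongr
    exact jap_mono (by norm_num) x
  rw [morawetz_apply, ip_add_left, ip_smul_left, euler_eq, map_sum, ip_sum_left]
  refine (norm_add_le _ _).trans ?_
  have h3 := (norm_sum_le Finset.univ fun j ↦
    ip (mulS (morawetzG n δ) (mulS (fun x ↦ x j) (dS j u))) v).trans
    (Finset.sum_le_sum fun j _ ↦ h1 j)
  rw [← Finset.mul_sum, ← Finset.sum_mul] at h3
  rw [norm_mul]
  simp only [map_ofNat, Complex.norm_ofNat]
  nlinarith

/-- Expresses quadratic forms as integrals, so that coercivity can be checked pointwise. -/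
theorem integrable_mul_norm_sq {g : Rn n → ℝ} (hg : g.HasTemperateGrowth) (u : 𝓢(Rn n, ℂ)) :
    Integrable (fun x ↦ g x * ‖u x‖ ^ 2) ∧ (ip (mulS g u) u).re = ∫ x, g x * ‖u x‖ ^ 2 := by
  have hi : Integrable (fun x ↦ inner ℂ (mulS g u x) (u x)) := by
    refine (L2.integrable_inner (𝕜 := ℂ) (toL n (mulS g u)) (toL n u)).congr ?_
    filter_upwards [(mulS g u).coeFn_toLp 2 volume, u.coeFn_toLp 2 volume] with x h1 h2
    change inner ℂ (((mulS g u).toLp 2 volume : Rn n → ℂ) x) ((u.toLp 2 volume : Rn n → ℂ) x) = _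
    rw [h1, h2]
  have he : (fun x ↦ g x * ‖u x‖ ^ 2) = fun x ↦ (inner ℂ (mulS g u x) (u x)).re := by
    ext x
    rw [mulS_apply hg, ← Complex.real_smul, inner_smul_left_eq_smul, Complex.smul_re,
      smul_eq_mul]
    congr 1
    exact (inner_self_eq_norm_sq (𝕜 := ℂ) (u x)).symm
  rw [he, ip_eq_integral]
  exact ⟨hi.re, (integral_re hi).symm⟩

theorem norm_euler_sq_le (u : 𝓢(Rn n, ℂ)) (x : Rn n) :
    ‖euler n u x‖ ^ 2 ≤ ‖x‖ ^ 2 * ∑ j, ‖dS j u x‖ ^ 2 := by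
  have h1 : ‖euler n u x‖ ≤ ∑ j, |x j| * ‖dS j u x‖ := by
    rw [euler_eq, sum_apply]
    refine (norm_sum_le _ _).trans (Finset.sum_le_sum fun j _ ↦ ?_)
    rw [mulS_apply (by fun_prop), norm_mul, Complex.norm_real, Real.norm_eq_abs]
  refine (pow_le_pow_left₀ (norm_nonneg _) h1 2).trans ?_
  refine (Finset.sum_mul_sq_le_sq_mul_sq _ _ _).trans (le_of_eq ?_)
  rw [EuclideanSpace.norm_sq_eq]
  simp only [Real.norm_eq_abs]

/-- The form has density g|∇u|² + h|x·∇u|². Since h ≤ 0 and |x·∇u| ≤ |x||∇u|, the worst direction is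
the radial one, with coefficient g + |x|²h. The profile g is chosen so that this is at least
δ⟨x⟩^{-1-δ}. -/
theorem morawetz_coercive {δ : ℝ} (hδ : 0 ≤ δ) (hδ1 : δ ≤ 1) (u : 𝓢(Rn n, ℂ)) :
    δ * ∑ i, wnorm (-((1 + δ) / 2)) (dS i u) ^ 2 ≤
      (ip (mulS (morawetzH n δ) (euler n u)) (euler n u)).re +
        ∑ i, (ip (mulS (morawetzG n δ) (dS i u)) (dS i u)).re := by
  have h0 : ∀ i, wnorm (-((1 + δ) / 2)) (dS i u) ^ 2 =
      ∫ x, jap n (-1 - δ) x * ‖dS i u x‖ ^ 2 := by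
    intro i
    rw [← (integrable_mul_norm_sq (by fun_prop) (dS i u)).2,
      show -1 - δ = 2 * -((1 + δ) / 2) by ring, ip_mulS_jap_self, Complex.ofReal_re]
  simp only [h0, (integrable_mul_norm_sq (hasTemperateGrowth_morawetzG (n := n) δ) _).2,
    (integrable_mul_norm_sq (hasTemperateGrowth_morawetzH (n := n) δ) _).2]
  have hiJ : ∀ i ∈ Finset.univ, Integrable (fun x ↦ jap n (-1 - δ) x * ‖dS i u x‖ ^ 2) :=
    fun i _ ↦ (integrable_mul_norm_sq (by fun_prop) (dS i u)).1
  have hiG : ∀ i ∈ Finset.univ, Integrable (fun x ↦ morawetzG n δ x * ‖dS i u x‖ ^ 2) :=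
    fun i _ ↦ (integrable_mul_norm_sq (by fun_prop) (dS i u)).1
  have hiH := (integrable_mul_norm_sq (hasTemperateGrowth_morawetzH (n := n) δ) (euler n u)).1
  rw [← integral_finsetSum _ hiJ, ← integral_finsetSum _ hiG, ← integral_const_mul,
    ← integral_add hiH (integrable_finsetSum _ hiG)]
  refine integral_mono ((integrable_finsetSum _ hiJ).const_mul δ)
    (hiH.add (integrable_finsetSum _ hiG)) fun x ↦ ?_
  simp only [← Finset.mul_sum]
  have hE := norm_euler_sq_le u x
  have hH := (morawetzH_mem hδ hδ1 x).2
  have hS : 0 ≤ ∑ j, ‖dS j u x‖ ^ 2 := by positivity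
  -- The surplus 2⟨x⟩^{-3} - (1+δ)⟨x⟩^{-3-δ} is nonnegative because δ ≤ 1; this explains the
  -- coefficient 2 in g.
  have hkey : δ * jap n (-1 - δ) x ≤ morawetzG n δ x + ‖x‖ ^ 2 * morawetzH n δ x := by
    have e1 : ‖x‖ ^ 2 * jap n (-3) x = jap n (-1) x - jap n (-3) x := by
      rw [show (-1 : ℝ) = 2 + -3 by norm_num, jap_add, jap_two]; ring
    have e2 : ‖x‖ ^ 2 * jap n (-3 - δ) x = jap n (-1 - δ) x - jap n (-3 - δ) x := by
      rw [show (-1 - δ : ℝ) = 2 + (-3 - δ) by ring, jap_add, jap_two]; ring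
    have h1 := jap_mono (by linarith : -3 - δ ≤ -3) x
    have h2 := jap_pos (-3 - δ) x
    have : morawetzG n δ x + ‖x‖ ^ 2 * morawetzH n δ x =
        δ * jap n (-1 - δ) x + (2 * jap n (-3) x - (1 + δ) * jap n (-3 - δ) x) := by
      simp only [morawetzG, morawetzH]
      linear_combination (-2) * e1 + (1 + δ) * e2
    rw [this]
    nlinarith
  nlinarith [mul_le_mul_of_nonneg_right hkey hS, mul_le_mul_of_nonpos_left hE hH]

/-- The real part of the pairing of (-Δ - ζ)u with the multiplier of u. The choice δ = 2σ - 1 makes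
the coercive weight exactly ⟨x⟩^{-2σ}. -/
theorem morawetz_estimate {σ : ℝ} (hσ : 1 / 2 ≤ σ) (hσ1 : σ ≤ 1) (ζ : ℂ) (u : 𝓢(Rn n, ℂ)) :
    2 * (2 * σ - 1) * ∑ i, wnorm (-σ) (dS i u) ^ 2 ≤
      (4 * ∑ j, wnorm (-σ) (dS j u) + (2 * n + 2) * wnorm (-σ) u) *
        wnorm σ (schrodingerS n ζ u) +
      (2 * n + 12) * (wnorm (-σ) u * ∑ i, wnorm (-σ) (dS i u)) +
      |ζ.im| * ((4 * ∑ j, wnorm 0 (dS j u) + (2 * n + 2) * wnorm 0 u) * wnorm 0 u) := by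
  set δ := 2 * σ - 1 with hδdef
  have hδ : 0 ≤ δ := by linarith
  have hδ1 : δ ≤ 1 := by linarith
  have hc := morawetz_coercive hδ hδ1 u
  rw [show (1 + δ) / 2 = σ by rw [hδdef]; ring] at hc
  have hid := ip_schrodingerS ζ u (morawetz n δ u)
  simp only [dS_morawetz, ip_add_left, ip_smul_left, Finset.sum_add_distrib, ← Finset.mul_sum] at hid
  have hE : ∑ i, ip (mulS (fun x ↦ x i) (mulS (morawetzH n δ) (euler n u))) (dS i u) =
      ip (mulS (morawetzH n δ) (euler n u)) (euler n u) := by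
    conv_rhs => rw [euler_eq u, ip_sum_right, ← euler_eq u]
    exact Finset.sum_congr rfl fun i _ ↦ ip_mulS (by fun_prop) _ _
  rw [hE, map_ofNat] at hid
  -- By antisymmetry the terms with the multiplier applied to ∂ᵢu drop out, and the pairing of the
  -- multiplier with u is purely imaginary, so that only Im ζ survives from ζ.
  have hre := congrArg Complex.re hid
  simp only [Complex.sub_re, Complex.add_re, Complex.mul_re, Complex.re_ofNat, Complex.im_ofNat,
    zero_mul, sub_zero, Complex.re_sum, re_ip_morawetz, Finset.sum_const_zero, mul_zero, zero_add,
    zero_sub] at hre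
  have hF := (Complex.abs_re_le_norm _).trans
    (norm_ip_morawetz_le hδ hδ1 σ u (schrodingerS n ζ u))
  have hU := (Complex.abs_im_le_norm _).trans (norm_ip_morawetz_le hδ hδ1 0 u u)
  rw [neg_zero] at hU
  have hB : ∀ i, |(ip (mulS (fun x ↦ x i * morawetzC n δ x) u) (dS i u)).re| ≤
      (2 * n + 12) * (wnorm (-σ) u * wnorm (-σ) (dS i u)) := fun i ↦
    (Complex.abs_re_le_norm _).trans (norm_ip_mulS_le (by fun_prop) (fun x ↦
      (abs_coord_mul_morawetzC_le hδ hδ1 i x).trans (by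
        gcongr
        exact jap_mono (by linarith) x)) _ _)
  have hBs := (Finset.abs_sum_le_sum_abs (fun i ↦
    (ip (mulS (fun x ↦ x i * morawetzC n δ x) u) (dS i u)).re) Finset.univ).trans
    (Finset.sum_le_sum fun i _ ↦ hB i)
  rw [← Finset.mul_sum, ← Finset.mul_sum] at hBs
  have hI := abs_mul ζ.im (ip (morawetz n δ u) u).im ▸
    mul_le_mul_of_nonneg_left hU (abs_nonneg ζ.im)
  have h1 := abs_le.mp hF
  have h2 := abs_le.mp hBs
  have h3 := abs_le.mp hI
  linarith [h1.1, h1.2, h2.1, h2.2, h3.1, h3.2]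

/-! ### Closing the estimates at high energy -/

/-- If Y > 2Bf then f ≤ Y, so B(fY + f²) ≤ 2BfY, which contradicts the hypothesis. -/
theorem le_of_sq_le_quadratic {B Y f : ℝ} (hB : 1 ≤ B) (hf : 0 ≤ f)
    (h : Y ^ 2 ≤ B * (f * Y + f ^ 2)) : Y ≤ 2 * B * f := by
  by_contra! hlt
  have h1 : f ≤ B * f := le_mul_of_one_le_left hf hB
  have h2 : f ≤ Y := by linarith
  have h3 : B * f * f ≤ B * f * Y := by gcongr
  rcases hf.eq_or_lt with rfl | hf'
  · nlinarith
  · nlinarith [mul_lt_mul_of_pos_right hlt (lt_of_lt_of_le hf' h2)]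

/-- The absorption argument that closes the energy and Morawetz estimates. -/
theorem absorb_energy_morawetz {δ K A : ℝ} (hδ : 0 < δ) (hA : 0 ≤ A) :
    ∃ C T : ℝ, 0 ≤ C ∧ 1 ≤ T ∧ ∀ t X Y f ε U G : ℝ, T ≤ t → 0 ≤ X → 0 ≤ Y → 0 ≤ f → 0 ≤ ε →
      0 ≤ U → 0 ≤ G → ε ≤ t ^ 2 → t ^ 2 * X ^ 2 ≤ Y ^ 2 + K * (X * Y) + f * X →
      δ * Y ^ 2 ≤ A * (f * Y + f * X + X * Y) + A * (ε * (G * U + U ^ 2)) →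
      ε * U ^ 2 ≤ f * X → G ^ 2 ≤ t ^ 2 * U ^ 2 + f * X →
      t * X ≤ C * f ∧ Y ≤ C * f := by
  set B : ℝ := 2 * (9 * A + δ) / δ with hB
  have hB1 : 1 ≤ B := by
    rw [hB, le_div_iff₀ hδ]
    linarith
  -- The threshold makes t² ≥ 2(K² + 1), which absorbs the cross term of the energy estimate, and δt
  -- ≥ 4A, which absorbs the XY term of the Morawetz estimate. The constant 4B + 2 comes from Y ≤
  -- 2Bf and tX ≤ 2Y + 2f.
  refine ⟨4 * B + 2, 1 + 2 * (K ^ 2 + 1) + 4 * A / δ, by linarith,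
    by have : 0 ≤ 4 * A / δ := by positivity
       nlinarith [sq_nonneg K], ?_⟩
  intro t X Y f ε U G ht hX hY hf hε hU hG hεt h1 h2 h3 h4
  have hAδ : 0 ≤ 4 * A / δ := by positivity
  have ht1 : 1 ≤ t := by nlinarith [sq_nonneg K]
  have htK : 2 * (K ^ 2 + 1) ≤ t ^ 2 := by nlinarith [sq_nonneg K]
  have htA : 4 * A ≤ δ * t := by
    have : 4 * A / δ ≤ t := by nlinarith [sq_nonneg K]
    rw [div_le_iff₀ hδ] at this
    linarith
  have hfX : 0 ≤ f * X := by positivity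
  -- Square and insert the bounds for G² and εU². Since ε ≤ t², both resulting terms are at most
  -- t²(fX)².
  have s1 : ε * (G * U) ≤ 2 * t * (f * X) := by
    refine le_of_sq_le_sq ?_ (by positivity)
    have e1 : (ε * (G * U)) ^ 2 = ε ^ 2 * U ^ 2 * G ^ 2 := by ring
    have e2 : ε ^ 2 * U ^ 2 * G ^ 2 ≤ ε ^ 2 * U ^ 2 * (t ^ 2 * U ^ 2 + f * X) := by gcongr
    have e3 : ε ^ 2 * U ^ 2 * (t ^ 2 * U ^ 2 + f * X) =
        t ^ 2 * (ε * U ^ 2) ^ 2 + ε * ((ε * U ^ 2) * (f * X)) := by ring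
    have e4 : t ^ 2 * (ε * U ^ 2) ^ 2 ≤ t ^ 2 * (f * X) ^ 2 := by gcongr
    have e5 : ε * ((ε * U ^ 2) * (f * X)) ≤ t ^ 2 * ((f * X) * (f * X)) := by gcongr
    nlinarith [sq_nonneg (t * (f * X))]
  -- The energy estimate, with KXY and fX split by Young's inequality and the X² parts absorbed on
  -- the left.
  have s2 : t * X ≤ 2 * Y + 2 * f := by
    refine le_of_sq_le_sq ?_ (by positivity)
    nlinarith [sq_nonneg (2 * Y - K * X), sq_nonneg (f - X), mul_nonneg hY hf, sq_nonneg X,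
      mul_le_mul_of_nonneg_right htK (sq_nonneg X), sq_nonneg (K * X)]
  -- Large t trades X for (Y + f)/t, so this term takes only half of δY² from the left-hand side.
  have s3 : A * (X * Y) ≤ δ / 4 * ((2 * Y + 2 * f) * Y) := by
    have e1 : 4 * A * (X * Y) ≤ δ * t * (X * Y) := by gcongr
    have e2 : δ * ((t * X) * Y) ≤ δ * ((2 * Y + 2 * f) * Y) := by gcongr
    linarith
  have s4 : f * X ≤ f * (t * X) := by
    gcongr
    nlinarith
  have s5 : f * (t * X) ≤ f * (2 * Y + 2 * f) := by gcongr
  have s6 : A * (ε * (G * U + U ^ 2)) ≤ A * (2 * (f * (t * X)) + f * (t * X)) := by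
    gcongr
    linarith
  have s7 : A * (f * X) ≤ A * (f * (2 * Y + 2 * f)) :=
    mul_le_mul_of_nonneg_left (s4.trans s5) hA
  have s8 : A * (f * (t * X)) ≤ A * (f * (2 * Y + 2 * f)) := mul_le_mul_of_nonneg_left s5 hA
  have s9 : Y ^ 2 ≤ B * (f * Y + f ^ 2) := by
    rw [hB, div_mul_eq_mul_div, le_div_iff₀ hδ]
    have q1 : 0 ≤ A * (f * Y) := by positivity
    have q2 : 0 ≤ A * f ^ 2 := by positivity
    have q3 : 0 ≤ δ * f ^ 2 := by positivity
    have q4 : 0 ≤ δ * (f * Y) := by positivity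
    linarith
  have s10 : Y ≤ 2 * B * f := le_of_sq_le_quadratic hB1 hf s9
  have s11 : 0 ≤ B * f := by positivity
  constructor <;> linarith

theorem le_sqrt_sum_sq (y : Fin n → ℝ) (i : Fin n) : y i ≤ √(∑ i, y i ^ 2) :=
  Real.le_sqrt_of_sq_le (Finset.single_le_sum (f := fun i ↦ y i ^ 2) (fun _ _ ↦ sq_nonneg _)
    (Finset.mem_univ i))

theorem sum_le_sqrt_sum_sq (y : Fin n → ℝ) : ∑ i, y i ≤ n * √(∑ i, y i ^ 2) := by
  simpa using Finset.sum_le_sum fun i (_ : i ∈ Finset.univ) ↦ le_sqrt_sum_sq y i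

/-- The energy and Morawetz estimates combined, as a statement about numbers. -/
theorem absorb_energy_morawetz_sum (n : ℕ) {σ : ℝ} (hσ : 1 / 2 < σ) :
    ∃ C T : ℝ, 0 ≤ C ∧ 1 ≤ T ∧ ∀ (ζ c : ℂ) (X U f f' : ℝ) (y g : Fin n → ℝ), T ≤ √‖ζ‖ →
      0 ≤ X → 0 ≤ U → 0 ≤ f → f' ≤ f →
      ‖((∑ i, y i ^ 2 : ℝ) : ℂ) - ζ * (X ^ 2 : ℝ)‖ ≤ 2 * σ * (X * ∑ i, y i) + X * f' →
      2 * (2 * σ - 1) * ∑ i, y i ^ 2 ≤ (4 * ∑ i, y i + (2 * n + 2) * X) * f +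
        (2 * n + 12) * (X * ∑ i, y i) + |ζ.im| * ((4 * ∑ i, g i + (2 * n + 2) * U) * U) →
      c = (∑ i, g i ^ 2 : ℝ) - ζ * (U ^ 2 : ℝ) → ‖c‖ ≤ X * f →
      √‖ζ‖ * X ≤ C * f ∧ ∀ i, y i ≤ C * f := by
  -- Passing from ∑ yᵢ to the ℓ² norm Y costs a factor n. This gives K = 2σn, and A = 4n + n(2n +
  -- 12) + 2 dominates every coefficient of the Morawetz estimate.
  obtain ⟨C, T, hC, hT, h⟩ := absorb_energy_morawetz (δ := 2 * (2 * σ - 1)) (K := 2 * σ * n)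
    (A := 4 * n + 12 * n + 2 + n * n * 2) (by linarith) (by positivity)
  refine ⟨C, T, hC, hT, fun ζ c X U f f' y g hζ hX0 hU0 hf0 hff hW hM hid hFu ↦ ?_⟩
  have hYs := sum_le_sqrt_sum_sq y
  have hGs := sum_le_sqrt_sum_sq g
  obtain ⟨Y, hY⟩ : ∃ Y, Y = √(∑ i, y i ^ 2) := ⟨_, rfl⟩
  obtain ⟨G, hG⟩ : ∃ G, G = √(∑ i, g i ^ 2) := ⟨_, rfl⟩
  have hY0 : 0 ≤ Y := hY ▸ Real.sqrt_nonneg _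
  have hG0 : 0 ≤ G := hG ▸ Real.sqrt_nonneg _
  have hYsq : Y ^ 2 = ∑ i, y i ^ 2 := hY ▸ Real.sq_sqrt (Finset.sum_nonneg fun _ _ ↦ sq_nonneg _)
  have hGsq : G ^ 2 = ∑ i, g i ^ 2 := hG ▸ Real.sq_sqrt (Finset.sum_nonneg fun _ _ ↦ sq_nonneg _)
  rw [← hY] at hYs
  rw [← hG] at hGs
  rw [← hYsq] at hW hM
  rw [← hGsq] at hid
  rw [mul_comm X f] at hFu
  have htsq : √‖ζ‖ ^ 2 = ‖ζ‖ := Real.sq_sqrt (norm_nonneg _)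
  have hσ0 : 0 ≤ σ := by linarith
  have key := h (√‖ζ‖) X Y f |ζ.im| U G hζ hX0 hY0 hf0 (abs_nonneg _) hU0 hG0
    (by rw [htsq]; exact Complex.abs_im_le_norm ζ) ?_ ?_ ?_ ?_
  · exact ⟨key.1, fun i ↦ (hY ▸ le_sqrt_sum_sq y i).trans key.2⟩
  · have h1 : ‖ζ * (X ^ 2 : ℝ)‖ = ‖ζ‖ * X ^ 2 := by
      rw [norm_mul, Complex.norm_real, Real.norm_of_nonneg (by positivity)]
    have h2 : ‖((Y ^ 2 : ℝ) : ℂ)‖ = Y ^ 2 := by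
      rw [Complex.norm_real, Real.norm_of_nonneg (by positivity)]
    have h3 := norm_sub_norm_le (ζ * (X ^ 2 : ℝ)) ((Y ^ 2 : ℝ) : ℂ)
    rw [norm_sub_rev, h1, h2] at h3
    have h4 : X * f' ≤ X * f := by gcongr
    have h5 : 2 * σ * (X * ∑ i, y i) ≤ 2 * σ * (X * (n * Y)) := by gcongr
    rw [htsq]
    linarith
  · refine hM.trans ?_
    have h1 : (4 * ∑ i, y i + (2 * n + 2) * X) * f ≤
        (4 * (n * Y) + (2 * n + 2) * X) * f := by gcongr
    have h2 : (2 * n + 12) * (X * ∑ i, y i) ≤ (2 * n + 12) * (X * (n * Y)) := by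
      gcongr
    have h3 : |ζ.im| * ((4 * ∑ i, g i + (2 * n + 2) * U) * U) ≤
        |ζ.im| * ((4 * (n * G) + (2 * n + 2) * U) * U) := by gcongr
    have p1 : 0 ≤ f * Y := by positivity
    have p2 : 0 ≤ f * X := by positivity
    have p3 : 0 ≤ X * Y := by positivity
    have p4 : 0 ≤ |ζ.im| * (G * U) := by positivity
    have p5 : 0 ≤ |ζ.im| * U ^ 2 := by positivity
    refine (add_le_add (add_le_add h1 h2) h3).trans (sub_nonneg.mp ?_)
    have : (4 * n + 12 * n + 2 + n * n * 2 : ℝ) * (f * Y + f * X + X * Y) +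
        (4 * n + 12 * n + 2 + n * n * 2) * (|ζ.im| * (G * U + U ^ 2)) -
        ((4 * (n * Y) + (2 * n + 2) * X) * f + (2 * n + 12) * (X * (n * Y)) +
          |ζ.im| * ((4 * (n * G) + (2 * n + 2) * U) * U)) =
        (12 * n + 2 + n * n * 2) * (f * Y) + (14 * n + n * n * 2) * (f * X) +
          (4 * n + 2) * (X * Y) + (12 * n + 2 + n * n * 2) * (|ζ.im| * (G * U)) +
          (14 * n + n * n * 2) * (|ζ.im| * U ^ 2) := by ring
    rw [this]
    positivity
  -- Imaginary part of the unweighted energy identity: the gradient term is real, which leaves |Im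
  -- ζ|U².
  · have h1 := (Complex.abs_im_le_norm _).trans hFu
    rw [hid] at h1
    simp only [Complex.sub_im, Complex.ofReal_im, Complex.im_mul_ofReal, zero_sub, abs_neg,
      abs_mul] at h1
    rwa [abs_of_nonneg (by positivity : 0 ≤ U ^ 2)] at h1
  -- Real part of the same identity, with Re ζ ≤ |ζ|.
  · have h1 := (Complex.abs_re_le_norm _).trans hFu
    rw [hid] at h1
    simp only [Complex.sub_re, Complex.ofReal_re, Complex.re_mul_ofReal] at h1
    have h2 := (abs_le.mp h1).2
    have h3 : ζ.re * U ^ 2 ≤ ‖ζ‖ * U ^ 2 := by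
      gcongr
      exact Complex.re_le_norm ζ
    rw [htsq]
    linarith

/-- The limiting absorption estimate at high energy for the free Schrödinger operator. -/
theorem high_energy_estimate (n : ℕ) {σ : ℝ} (hσ : 1 / 2 < σ) (hσ1 : σ ≤ 1) :
    ∃ C T : ℝ, 0 ≤ C ∧ 1 ≤ T ∧ ∀ ζ : ℂ, T ≤ √‖ζ‖ → ∀ u : 𝓢(Rn n, ℂ),
      √‖ζ‖ * wnorm (-σ) u ≤ C * wnorm σ (schrodingerS n ζ u) ∧
      ∀ i, wnorm (-σ) (dS i u) ≤ C * wnorm σ (schrodingerS n ζ u) := by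
  obtain ⟨C, T, hC, hT, h⟩ := absorb_energy_morawetz_sum n hσ
  refine ⟨C, T, hC, hT, fun ζ hζ u ↦ ?_⟩
  refine h ζ (ip u (schrodingerS n ζ u)) (wnorm (-σ) u) (wnorm 0 u) _ _
    (fun i ↦ wnorm (-σ) (dS i u)) (fun i ↦ wnorm 0 (dS i u)) hζ (wnorm_nonneg _ _)
    (wnorm_nonneg _ _) (wnorm_nonneg _ _) (wnorm_mono (by linarith) _)
    (weighted_energy (by linarith) ζ u) (morawetz_estimate hσ.le hσ1 ζ u) ?_ (norm_ip_le σ _ _)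
  rw [ip_schrodingerS, Complex.ofReal_sum]
  simp only [ip_self]

/-! ### The resolvent on Schwartz functions, dilations and powers of the resolvent -/

/-- The resolvent `(-Δ - ζ)⁻¹` on Schwartz functions. -/
def resolventS (n : ℕ) (ζ : ℂ) : 𝓢(Rn n, ℂ) →L[ℂ] 𝓢(Rn n, ℂ) :=
  SchwartzMap.fourierMultiplierCLM ℂ (fun ξ : Rn n ↦ (((2 * π) ^ 2 * ‖ξ‖ ^ 2 : ℝ) - ζ : ℂ)⁻¹)

theorem schrodingerS_eq_fourierMultiplier (ζ : ℂ) :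
    schrodingerS n ζ = SchwartzMap.fourierMultiplierCLM ℂ
      (fun ξ : Rn n ↦ (((2 * π) ^ 2 * ‖ξ‖ ^ 2 : ℝ) - ζ : ℂ)) := by
  have h : (fun ξ : Rn n ↦ (((2 * π) ^ 2 * ‖ξ‖ ^ 2 : ℝ) - ζ : ℂ)) =
      ((((2 * π) ^ 2 : ℝ) : ℂ) • fun ξ : Rn n ↦ ((‖ξ‖ ^ 2 : ℝ) : ℂ)) - fun _ ↦ ζ := by
    ext ξ
    simp
  have hL : ∀ u : 𝓢(Rn n, ℂ), ∑ i, dS i (dS i u) = Laplacian.laplacian u := fun u ↦ by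
    rw [SchwartzMap.laplacian_eq_sum (EuclideanSpace.basisFun (Fin n) ℝ)]
    simp [dS]
  ext1 u
  rw [schrodingerS_apply, hL, SchwartzMap.laplacian_eq_fourierMultiplierCLM,
    ← SchwartzMap.fourierMultiplierCLM_ofReal ℂ (by fun_prop), h]
  simp only [SchwartzMap.fourierMultiplierCLM_apply]
  rw [SchwartzMap.smulLeftCLM_sub (by fun_prop) (by fun_prop),
    SchwartzMap.smulLeftCLM_smul (by fun_prop), sub_apply, SchwartzMap.smulLeftCLM_const]
  simp only [smul_apply, ContinuousLinearMap.id_apply]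
  rw [sub_eq_add_neg (_ • _), ← neg_smul ζ, FourierTransform.fourierInv_add,
    FourierTransform.fourierInv_smul, FourierTransform.fourierInv_smul,
    FourierTransform.fourierInv_fourier_eq, neg_smul, neg_neg, neg_smul, ← sub_eq_add_neg,
    Complex.coe_smul]
  rfl

theorem symbol_ne_zero {ζ : ℂ} (hζ : ζ ∈ slit) (ξ : Rn n) :
    (((2 * π) ^ 2 * ‖ξ‖ ^ 2 : ℝ) - ζ : ℂ) ≠ 0 := by
  obtain ⟨d, hd, hdist⟩ := exists_le_norm_sub hζ
  exact norm_pos_iff.mp (hd.trans (hdist _ (by positivity)))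

theorem schrodingerS_mul_resolventS {ζ : ℂ} (hζ : ζ ∈ slit) :
    schrodingerS n ζ * resolventS n ζ = 1 := by
  rw [ContinuousLinearMap.mul_def, schrodingerS_eq_fourierMultiplier, resolventS,
    SchwartzMap.fourierMultiplierCLM_compL_fourierMultiplierCLM (by fun_prop)
    (hasTemperateGrowth_inv_symbol n hζ)]
  rw [show ((fun ξ : Rn n ↦ (((2 * π) ^ 2 * ‖ξ‖ ^ 2 : ℝ) - ζ : ℂ)) *
      fun ξ : Rn n ↦ (((2 * π) ^ 2 * ‖ξ‖ ^ 2 : ℝ) - ζ : ℂ)⁻¹) = fun _ ↦ (1 : ℂ) from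
    funext fun ξ ↦ mul_inv_cancel₀ (symbol_ne_zero hζ ξ), SchwartzMap.fourierMultiplierCLM_const,
    one_smul]
  rfl

theorem resolventS_mul_schrodingerS {ζ : ℂ} (hζ : ζ ∈ slit) :
    resolventS n ζ * schrodingerS n ζ = 1 := by
  rw [ContinuousLinearMap.mul_def, schrodingerS_eq_fourierMultiplier, resolventS,
    SchwartzMap.fourierMultiplierCLM_compL_fourierMultiplierCLM
    (hasTemperateGrowth_inv_symbol n hζ) (by fun_prop)]
  rw [show ((fun ξ : Rn n ↦ (((2 * π) ^ 2 * ‖ξ‖ ^ 2 : ℝ) - ζ : ℂ)⁻¹) *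
      fun ξ : Rn n ↦ (((2 * π) ^ 2 * ‖ξ‖ ^ 2 : ℝ) - ζ : ℂ)) = fun _ ↦ (1 : ℂ) from
    funext fun ξ ↦ inv_mul_cancel₀ (symbol_ne_zero hζ ξ), SchwartzMap.fourierMultiplierCLM_const,
    one_smul]
  rfl

/-- The Laplacian is homogeneous of degree two under dilations: [-Δ, x·∇] = 2(-Δ), and -Δ is the
Schrödinger operator plus ζ. -/
theorem schrodingerS_mul_euler (ζ : ℂ) :
    schrodingerS n ζ * euler n =
      euler n * schrodingerS n ζ + (2 : ℂ) • schrodingerS n ζ + (2 * ζ) • 1 := by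
  ext1 u
  simp only [mul_apply_eq_comp, add_apply, smul_apply, one_apply_eq_self,
    schrodingerS_apply, dS_euler, map_add, map_sub, map_neg, map_sum, map_smul,
    Finset.sum_add_distrib]
  module

theorem dS_mul_schrodingerS (ζ : ℂ) (i : Fin n) :
    dS i * schrodingerS n ζ = schrodingerS n ζ * dS i := by
  ext1 u
  simp only [mul_apply_eq_comp, schrodingerS_apply, map_sub, map_neg, map_sum,
    map_smul]
  congr 2
  refine Finset.sum_congr rfl fun j _ ↦ ?_
  rw [dS_comm i j, dS_comm i j]

theorem resolventS_comm_dS {ζ : ℂ} (hζ : ζ ∈ slit) (i : Fin n) :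
    Commute (resolventS n ζ) (dS i) := by
  have h1 := schrodingerS_mul_resolventS (n := n) hζ
  have h2 := resolventS_mul_schrodingerS (n := n) hζ
  calc resolventS n ζ * dS i = resolventS n ζ * (dS i * schrodingerS n ζ) * resolventS n ζ := by
        rw [mul_assoc, mul_assoc, h1, mul_one]
    _ = dS i * resolventS n ζ := by
        rw [dS_mul_schrodingerS, ← mul_assoc, h2, one_mul]

theorem euler_mul_resolventS {ζ : ℂ} (hζ : ζ ∈ slit) :
    euler n * resolventS n ζ = resolventS n ζ * euler n + (2 : ℂ) • resolventS n ζ +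
      (2 * ζ) • resolventS n ζ ^ 2 := by
  have h1 := schrodingerS_mul_resolventS (n := n) hζ
  have h2 := resolventS_mul_schrodingerS (n := n) hζ
  have h3 := congrArg (fun A ↦ resolventS n ζ * A * resolventS n ζ)
    (schrodingerS_mul_euler (n := n) ζ)
  simp only [mul_add, add_mul, mul_smul_comm, smul_mul_assoc, mul_one] at h3
  rwa [← mul_assoc, h2, one_mul, mul_assoc (resolventS n ζ), mul_assoc (euler n), h1, mul_one,
    one_mul, ← sq] at h3

/-- Solved for the last term, this expresses ζ R^{j+1} through R^j and the Euler operator; it drives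
the induction on powers. -/
theorem euler_mul_resolventS_pow {ζ : ℂ} (hζ : ζ ∈ slit) (j : ℕ) :
    euler n * resolventS n ζ ^ j = resolventS n ζ ^ j * euler n +
      (2 * j : ℂ) • resolventS n ζ ^ j + (2 * j * ζ) • resolventS n ζ ^ (j + 1) := by
  induction j with
  | zero => simp
  | succ j ih =>
    rw [pow_succ (resolventS n ζ) j, ← mul_assoc, ih]
    simp only [add_mul, smul_mul_assoc]
    rw [mul_assoc _ (euler n), euler_mul_resolventS hζ]
    simp only [mul_add, mul_smul_comm, ← pow_succ, ← pow_add, ← mul_assoc]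
    push_cast
    module

/-- Puts the derivative outermost. As ∂ᵢ commutes with the resolvent, the derivative of F in
R^j(x·∇F) becomes a derivative of a resolvent power, which the induction controls. -/
theorem euler_eq_sum_dS (u : 𝓢(Rn n, ℂ)) :
    euler n u = ∑ i, dS i (mulS (fun x ↦ x i) u) - (n : ℂ) • u := by
  simp only [dS_coord, if_pos, Finset.sum_add_distrib, euler_eq]
  simp only [Finset.sum_const, Finset.card_univ, Fintype.card_fin]
  rw [← Nat.cast_smul_eq_nsmul ℂ]
  abel

/-- The weighted `L²` bounds for the powers of the resolvent at high energy, and for their first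
derivatives. -/
theorem resolventS_pow_estimate (n j : ℕ) : ∀ σ : ℝ, (j : ℝ) + 1 / 2 < σ →
    ∃ C T : ℝ, 0 ≤ C ∧ 1 ≤ T ∧ ∀ ζ ∈ slit, T ≤ √‖ζ‖ → ∀ F : 𝓢(Rn n, ℂ),
      √‖ζ‖ ^ (j + 1) * wnorm (-σ) ((resolventS n ζ ^ (j + 1)) F) ≤ C * wnorm σ F ∧
      ∀ i, √‖ζ‖ ^ j * wnorm (-σ) (dS i ((resolventS n ζ ^ (j + 1)) F)) ≤ C * wnorm σ F := by
  induction j with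
  | zero =>
    intro σ hσ
    -- The Morawetz estimate needs σ ≤ 1; for larger σ the weighted bound is weaker, by monotonicity
    -- of the weights.
    obtain ⟨C, T, hC, hT, h⟩ := high_energy_estimate n (σ := min σ 1)
      (lt_min (by simpa using hσ) (by norm_num)) (min_le_right _ _)
    refine ⟨C, T, hC, hT, fun ζ hζ hTζ F ↦ ?_⟩
    have h1 := h ζ hTζ (resolventS n ζ F)
    have hQ : schrodingerS n ζ (resolventS n ζ F) = F := by
      rw [← mul_apply_eq_comp, schrodingerS_mul_resolventS hζ]; rfl
    rw [hQ] at h1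
    have hm : ∀ v : 𝓢(Rn n, ℂ), wnorm (-σ) v ≤ wnorm (-min σ 1) v := fun v ↦
      wnorm_mono (neg_le_neg (min_le_left _ _)) v
    have hF : C * wnorm (min σ 1) F ≤ C * wnorm σ F :=
      mul_le_mul_of_nonneg_left (wnorm_mono (min_le_left _ _) F) hC
    simp only [zero_add, pow_one, pow_zero, one_mul]
    exact ⟨((mul_le_mul_of_nonneg_left (hm _) (Real.sqrt_nonneg _)).trans h1.1).trans hF,
      fun i ↦ ((hm _).trans (h1.2 i)).trans hF⟩
  | succ j ih =>
    intro σ hσ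
    push_cast at hσ
    have hj0 : (0 : ℝ) ≤ j := Nat.cast_nonneg j
    have hn0 : (0 : ℝ) ≤ n := Nat.cast_nonneg n
    obtain ⟨C, T, hC, hT, h⟩ := ih (σ - 1) (by linarith)
    -- In the commutator identity the term A R^{j+1} contributes n, the term R^{j+1} A contributes
    -- 2n, and 2(j+1) R^{j+1} contributes 2(j+1).
    set C₁ : ℝ := (3 * n + 2 * (j + 1)) * C with hC₁
    have hC₁0 : 0 ≤ C₁ := by positivity
    set K : ℝ := 2 * σ * n with hK
    have hK0 : 0 ≤ K := by have : 0 ≤ σ := by linarith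
                           positivity
    -- The coefficients of the energy inequality after multiplication by t^{2(j+1)}; the 1 ensures B
    -- ≥ 1.
    set B : ℝ := 1 + C₁ ^ 2 + K * C₁ + C * C₁ with hB
    have hB1 : 1 ≤ B := by
      have : 0 ≤ C₁ ^ 2 + K * C₁ + C * C₁ := by positivity
      linarith
    refine ⟨C₁ + 2 * B, T, by linarith, hT, fun ζ hζ hTζ F ↦ ?_⟩
    set t := √‖ζ‖ with ht
    have ht1 : 1 ≤ t := hT.trans hTζ
    have ht0 : 0 < t := by linarith
    have htsq : t ^ 2 = ‖ζ‖ := Real.sq_sqrt (norm_nonneg _)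
    set R := resolventS n ζ with hR
    set f := wnorm σ F with hf
    have hf0 : 0 ≤ f := wnorm_nonneg _ _
    have hFf : wnorm (σ - 1) F ≤ f := wnorm_mono (by linarith) F
    have hv : t ^ (j + 1) * wnorm (-σ) ((R ^ (j + 1)) F) ≤ C * f :=
      ((mul_le_mul_of_nonneg_left (wnorm_mono (by linarith) _) (by positivity)).trans
        (h ζ hζ hTζ F).1).trans (mul_le_mul_of_nonneg_left hFf hC)
    have hxS : ∀ (i : Fin n) (v : 𝓢(Rn n, ℂ)) (p : ℝ),
        wnorm p (mulS (fun x ↦ x i) v) ≤ wnorm (p + 1) v := fun i v p ↦ by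
      simpa using wnorm_mulS_le (p := p) (q := p + 1) (C := 1) (g := fun x : Rn n ↦ x i)
        (by fun_prop) (fun x ↦ by simpa using abs_coord_le_jap_one x i) v
    -- The factor xᵢ turns the weight -σ into -(σ - 1), the one at which the induction hypothesis is
    -- applied.
    have hEv : t ^ j * wnorm (-σ) (euler n ((R ^ (j + 1)) F)) ≤ n * (C * f) := by
      rw [euler_eq]
      calc t ^ j * wnorm (-σ) (∑ i, mulS (fun x ↦ x i) (dS i ((R ^ (j + 1)) F)))
          ≤ t ^ j * ∑ i, wnorm (-σ) (mulS (fun x ↦ x i) (dS i ((R ^ (j + 1)) F))) := by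
            gcongr
            exact wnorm_sum_le _ _ _
        _ = ∑ i, t ^ j * wnorm (-σ) (mulS (fun x ↦ x i) (dS i ((R ^ (j + 1)) F))) :=
            Finset.mul_sum _ _ _
        _ ≤ ∑ _i : Fin n, C * f := by
            refine Finset.sum_le_sum fun i _ ↦ ?_
            refine (mul_le_mul_of_nonneg_left (hxS i _ _) (by positivity)).trans ?_
            rw [show -σ + 1 = -(σ - 1) by ring]
            exact ((h ζ hζ hTζ F).2 i).trans (mul_le_mul_of_nonneg_left hFf hC)
        _ = n * (C * f) := by simp
    have hvj : t ^ j * wnorm (-σ) ((R ^ (j + 1)) F) ≤ C * f := by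
      refine le_trans ?_ hv
      gcongr
      exacts [wnorm_nonneg _ _, Nat.le_succ j]
    have hRE : t ^ j * wnorm (-σ) ((R ^ (j + 1)) (euler n F)) ≤ 2 * n * (C * f) := by
      have hcomm : ∀ (i : Fin n) (v : 𝓢(Rn n, ℂ)),
          (R ^ (j + 1)) (dS i v) = dS i ((R ^ (j + 1)) v) := fun i v ↦
        DFunLike.congr_fun ((resolventS_comm_dS hζ i).pow_left (j + 1)).eq v
      rw [euler_eq_sum_dS, map_sub, map_sum, map_smul]
      have e1 : t ^ j * wnorm (-σ) (∑ i, (R ^ (j + 1)) (dS i (mulS (fun x ↦ x i) F))) ≤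
          n * (C * f) := by
        calc _ ≤ t ^ j * ∑ i, wnorm (-σ) ((R ^ (j + 1)) (dS i (mulS (fun x ↦ x i) F))) := by
              gcongr
              exact wnorm_sum_le _ _ _
          _ = ∑ i, t ^ j * wnorm (-σ) ((R ^ (j + 1)) (dS i (mulS (fun x ↦ x i) F))) :=
              Finset.mul_sum _ _ _
          _ ≤ ∑ _i : Fin n, C * f := by
              refine Finset.sum_le_sum fun i _ ↦ ?_
              rw [hcomm]
              refine (mul_le_mul_of_nonneg_left (wnorm_mono (by linarith) _)
                (by positivity)).trans (((h ζ hζ hTζ _).2 i).trans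
                (mul_le_mul_of_nonneg_left ?_ hC))
              simpa using hxS i F (σ - 1)
          _ = n * (C * f) := by simp
      refine (mul_le_mul_of_nonneg_left (wnorm_sub_le _ _ _) (by positivity)).trans ?_
      rw [wnorm_smul, Complex.norm_natCast]
      nlinarith
    -- The commutator identity divided by 2(j+1)ζ: its right-hand side is O(t^{-j}), and ζ supplies
    -- the factor t².
    have hA : t ^ (j + 2) * wnorm (-σ) ((R ^ (j + 2)) F) ≤ C₁ * f := by
      have hid := DFunLike.congr_fun (euler_mul_resolventS_pow (n := n) hζ (j + 1)) F
      simp only [mul_apply_eq_comp, add_apply, smul_apply] at hid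
      have hid' : (2 * ((j + 1 : ℕ) : ℂ) * ζ) • (R ^ (j + 2)) F =
          euler n ((R ^ (j + 1)) F) - (R ^ (j + 1)) (euler n F) -
            (2 * ((j + 1 : ℕ) : ℂ)) • (R ^ (j + 1)) F := by
        rw [hid]
        abel
      have h1 : 2 * (j + 1 : ℝ) * t ^ 2 * wnorm (-σ) ((R ^ (j + 2)) F) ≤
          wnorm (-σ) (euler n ((R ^ (j + 1)) F)) + wnorm (-σ) ((R ^ (j + 1)) (euler n F)) +
            2 * (j + 1 : ℝ) * wnorm (-σ) ((R ^ (j + 1)) F) := by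
        have e := congrArg (wnorm (-σ)) hid'
        have hc : ‖(2 * ((j + 1 : ℕ) : ℂ))‖ = 2 * (j + 1 : ℝ) := by
          rw [norm_mul, Complex.norm_natCast]
          simp
        rw [wnorm_smul, norm_mul, hc, ← htsq] at e
        rw [e]
        refine (wnorm_sub_le _ _ _).trans ?_
        rw [wnorm_smul, hc]
        gcongr
        exact wnorm_sub_le _ _ _
      have h2 := mul_le_mul_of_nonneg_left h1 (by positivity : 0 ≤ t ^ j)
      have h3 : t ^ (j + 2) * wnorm (-σ) ((R ^ (j + 2)) F) ≤
          2 * (j + 1 : ℝ) * (t ^ (j + 2) * wnorm (-σ) ((R ^ (j + 2)) F)) := by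
        refine le_mul_of_one_le_left (mul_nonneg (by positivity) (wnorm_nonneg _ _)) ?_
        linarith
      have h4 : t ^ j * (2 * (j + 1 : ℝ) * t ^ 2 * wnorm (-σ) ((R ^ (j + 2)) F)) =
          2 * (j + 1 : ℝ) * (t ^ (j + 2) * wnorm (-σ) ((R ^ (j + 2)) F)) := by ring
      have h5 : 2 * (j + 1 : ℝ) * (t ^ j * wnorm (-σ) ((R ^ (j + 1)) F)) ≤
          2 * (j + 1 : ℝ) * (C * f) := by gcongr
      rw [hC₁]
      linarith
    refine ⟨hA.trans (mul_le_mul_of_nonneg_right (by linarith) hf0), fun i ↦ ?_⟩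
    have hQ : schrodingerS n ζ ((R ^ (j + 2)) F) = (R ^ (j + 1)) F := by
      rw [← mul_apply_eq_comp, pow_succ' R (j + 1), ← mul_assoc,
        schrodingerS_mul_resolventS hζ, one_mul]
    -- For the gradient no commutator is needed: R^{j+2}F solves the equation with right-hand side
    -- R^{j+1}F, and the energy estimate bounds its gradient by what is already known.
    have hW := weighted_energy (by linarith : 0 ≤ σ) ζ ((R ^ (j + 2)) F)
    rw [hQ] at hW
    refine le_trans ?_ (mul_le_mul_of_nonneg_right (by linarith : 2 * B ≤ C₁ + 2 * B) hf0)
    have hX0 := wnorm_nonneg (-σ) ((R ^ (j + 2)) F)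
    have hV0 := wnorm_nonneg (-σ) ((R ^ (j + 1)) F)
    generalize wnorm (-σ) ((R ^ (j + 2)) F) = X at *
    generalize wnorm (-σ) ((R ^ (j + 1)) F) = V at *
    obtain ⟨y, hy⟩ : ∃ y : Fin n → ℝ, y = fun i ↦ wnorm (-σ) (dS i ((R ^ (j + 2)) F)) := ⟨_, rfl⟩
    have hyi : ∀ i, wnorm (-σ) (dS i ((R ^ (j + 2)) F)) = y i := fun i ↦ by rw [hy]
    simp only [hyi] at hW
    change t ^ (j + 1) * wnorm (-σ) (dS i ((R ^ (j + 2)) F)) ≤ _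
    rw [hyi i]
    have hYs := sum_le_sqrt_sum_sq y
    have hYi := le_sqrt_sum_sq y i
    obtain ⟨Y, hY⟩ : ∃ Y, Y = √(∑ i, y i ^ 2) := ⟨_, rfl⟩
    have hY0 : 0 ≤ Y := hY ▸ Real.sqrt_nonneg _
    have hYsq : Y ^ 2 = ∑ i, y i ^ 2 :=
      hY ▸ Real.sq_sqrt (Finset.sum_nonneg fun _ _ ↦ sq_nonneg _)
    rw [← hY] at hYs hYi
    rw [← hYsq] at hW
    refine (mul_le_mul_of_nonneg_left hYi (by positivity)).trans ?_
    refine le_of_sq_le_quadratic hB1 hf0 ?_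
    have h1 : Y ^ 2 ≤ t ^ 2 * X ^ 2 + K * (X * Y) + X * V := by
      have e1 : ‖ζ * (X ^ 2 : ℝ)‖ = t ^ 2 * X ^ 2 := by
        rw [norm_mul, Complex.norm_real, Real.norm_of_nonneg (by positivity), htsq]
      have e2 : ‖((Y ^ 2 : ℝ) : ℂ)‖ = Y ^ 2 := by
        rw [Complex.norm_real, Real.norm_of_nonneg (by positivity)]
      have e3 := norm_sub_norm_le ((Y ^ 2 : ℝ) : ℂ) (ζ * (X ^ 2 : ℝ))
      rw [e1, e2] at e3
      have e4 : 2 * σ * (X * ∑ i, y i) ≤ 2 * σ * (X * (n * Y)) := by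
        have : 0 ≤ σ := by linarith
        gcongr
      rw [hK]
      linarith
    have hXt : t ^ (j + 1) * X ≤ C₁ * f := by
      refine le_trans ?_ hA
      gcongr
      norm_num
    have m1 : (t ^ (j + 2) * X) ^ 2 ≤ (C₁ * f) ^ 2 := by gcongr
    have m2 : K * ((t ^ (j + 1) * X) * (t ^ (j + 1) * Y)) ≤ K * ((C₁ * f) * (t ^ (j + 1) * Y)) := by
      gcongr
    have m3 : (t ^ (j + 1) * X) * (t ^ (j + 1) * V) ≤ (C₁ * f) * (C * f) := by gcongr
    have m4 := mul_le_mul_of_nonneg_left h1 (by positivity : 0 ≤ (t ^ (j + 1)) ^ 2)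
    have q1 : 0 ≤ f * (t ^ (j + 1) * Y) := by positivity
    have q2 : 0 ≤ C₁ ^ 2 * (f * (t ^ (j + 1) * Y)) := by positivity
    have q3 : 0 ≤ C * C₁ * (f * (t ^ (j + 1) * Y)) := by positivity
    have q4 : 0 ≤ K * C₁ * f ^ 2 := by positivity
    have q5 := sq_nonneg f
    calc (t ^ (j + 1) * Y) ^ 2 = (t ^ (j + 1)) ^ 2 * Y ^ 2 := by ring
      _ ≤ _ := m4
      _ = (t ^ (j + 2) * X) ^ 2 + K * ((t ^ (j + 1) * X) * (t ^ (j + 1) * Y)) +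
          (t ^ (j + 1) * X) * (t ^ (j + 1) * V) := by ring
      _ ≤ (C₁ * f) ^ 2 + K * ((C₁ * f) * (t ^ (j + 1) * Y)) + (C₁ * f) * (C * f) := by linarith
      _ ≤ B * (f * (t ^ (j + 1) * Y) + f ^ 2) := by
          rw [hB]
          linarith

end WeightedSobolev
end

noncomputable section

namespace WeightedSobolev

open scoped BoundedContinuousFunction FourierTransform Asymptotics

variable {n : ℕ}

/-! ### Multiplication operators and Fourier multipliers on L² -/

/-- The Hilbert space `L²(ℝⁿ)`. -/
abbrev L2n (n : ℕ) : Type := Lp ℂ 2 (volume : Measure (Rn n))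

/-- The product of a bounded continuous function and an `L²` function. -/
def bmulFun (m : Rn n →ᵇ ℂ) (f : L2n n) : L2n n :=
  (m.memLp_top.toLp _ : Lp ℂ ⊤ (volume : Measure (Rn n))) • f

theorem coeFn_bmulFun (m : Rn n →ᵇ ℂ) (f : L2n n) :
    bmulFun m f =ᵐ[volume] fun x ↦ m x * f x := by
  filter_upwards [Lp.coeFn_lpSMul (r := 2) (m.memLp_top.toLp _ : Lp ℂ ⊤ (volume : Measure (Rn n))) f,
    (m.memLp_top (μ := (volume : Measure (Rn n)))).coeFn_toLp] with x h1 h2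
  rw [bmulFun, h1, Pi.smul_apply', h2, smul_eq_mul]

/-- The action of the bounded continuous functions on `L²` by multiplication. -/
def bmul (n : ℕ) : (Rn n →ᵇ ℂ) →L[ℂ] L2n n →L[ℂ] L2n n :=
  LinearMap.mkContinuous₂ (LinearMap.mk₂ ℂ (fun m f ↦ bmulFun m f)
    (fun m₁ m₂ f ↦ by
      refine Lp.ext ?_
      filter_upwards [coeFn_bmulFun (m₁ + m₂) f, coeFn_bmulFun m₁ f, coeFn_bmulFun m₂ f,
        Lp.coeFn_add (bmulFun m₁ f) (bmulFun m₂ f)] with x h1 h2 h3 h4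
      rw [h1, h4, Pi.add_apply, h2, h3, BoundedContinuousFunction.add_apply, add_mul])
    (fun c m f ↦ by
      refine Lp.ext ?_
      filter_upwards [coeFn_bmulFun (c • m) f, coeFn_bmulFun m f,
        Lp.coeFn_smul c (bmulFun m f)] with x h1 h2 h3
      rw [h1, h3, Pi.smul_apply, h2, BoundedContinuousFunction.smul_apply, smul_mul_assoc])
    (fun m f₁ f₂ ↦ by
      refine Lp.ext ?_
      filter_upwards [coeFn_bmulFun m (f₁ + f₂), coeFn_bmulFun m f₁, coeFn_bmulFun m f₂,
        Lp.coeFn_add (bmulFun m f₁) (bmulFun m f₂), Lp.coeFn_add f₁ f₂] with x h1 h2 h3 h4 h5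
      rw [h1, h4, Pi.add_apply, h2, h3, h5, Pi.add_apply, mul_add])
    (fun c m f ↦ by
      refine Lp.ext ?_
      filter_upwards [coeFn_bmulFun m (c • f), coeFn_bmulFun m f,
        Lp.coeFn_smul c (bmulFun m f), Lp.coeFn_smul c f] with x h1 h2 h3 h4
      rw [h1, h3, Pi.smul_apply, h2, h4, Pi.smul_apply, mul_smul_comm])) 1
    (fun m f ↦ by
      rw [one_mul]
      refine Lp.norm_le_mul_norm_of_ae_le_mul ?_
      filter_upwards [coeFn_bmulFun m f] with x h1
      simp only [LinearMap.mk₂_apply]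
      rw [h1, norm_mul]
      gcongr
      exact m.norm_coe_le_norm x)

theorem bmul_apply (m : Rn n →ᵇ ℂ) (f : L2n n) : bmul n m f = bmulFun m f := rfl

theorem norm_bmul_le (m : Rn n →ᵇ ℂ) : ‖bmul n m‖ ≤ ‖m‖ := by
  refine ContinuousLinearMap.opNorm_le_bound _ (norm_nonneg _) fun f ↦ ?_
  refine Lp.norm_le_mul_norm_of_ae_le_mul ?_
  filter_upwards [coeFn_bmulFun m f] with x h1
  rw [bmul_apply, h1, norm_mul]
  gcongr
  exact m.norm_coe_le_norm x

theorem bmul_toL (m : Rn n →ᵇ ℂ) (hm : (m : Rn n → ℂ).HasTemperateGrowth) (u : 𝓢(Rn n, ℂ)) :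
    bmul n m (toL n u) = toL n (SchwartzMap.smulLeftCLM ℂ m u) := by
  refine Lp.ext ?_
  filter_upwards [coeFn_bmulFun m (toL n u), u.coeFn_toLp 2 volume,
    (SchwartzMap.smulLeftCLM ℂ m u).coeFn_toLp 2 volume] with x h1 h2 h3
  change (bmulFun m (toL n u) : Rn n → ℂ) x =
    ((SchwartzMap.smulLeftCLM ℂ m u).toLp 2 volume : Rn n → ℂ) x
  rw [h1, h3, SchwartzMap.smulLeftCLM_apply_apply hm, smul_eq_mul]
  congr 1

theorem toTempered_bmul (m : Rn n →ᵇ ℂ) (hm : (m : Rn n → ℂ).HasTemperateGrowth) (f : L2n n) :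
    Lp.toTemperedDistributionCLM ℂ volume 2 (bmul n m f) =
      TemperedDistribution.smulLeftCLM ℂ m (Lp.toTemperedDistributionCLM ℂ volume 2 f) :=
  Lp.toTemperedDistribution_smul_eq hm m.memLp_top f

/-- The Fourier transform as a continuous linear map on `L²`. -/
def fourierL (n : ℕ) : L2n n →L[ℂ] L2n n :=
  (Lp.fourierTransformₗᵢ (Rn n) ℂ).toContinuousLinearEquiv

/-- The inverse Fourier transform as a continuous linear map on `L²`. -/
def fourierInvL (n : ℕ) : L2n n →L[ℂ] L2n n :=
  (Lp.fourierTransformₗᵢ (Rn n) ℂ).symm.toContinuousLinearEquiv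

theorem norm_fourierL_apply (f : L2n n) : ‖fourierL n f‖ = ‖f‖ :=
  (Lp.fourierTransformₗᵢ (Rn n) ℂ).norm_map f

theorem norm_fourierInvL_apply (f : L2n n) : ‖fourierInvL n f‖ = ‖f‖ :=
  (Lp.fourierTransformₗᵢ (Rn n) ℂ).symm.norm_map f

/-- The Fourier multiplier on `L²` with a bounded continuous symbol. -/
def fmul (n : ℕ) : (Rn n →ᵇ ℂ) →L[ℂ] L2n n →L[ℂ] L2n n :=
  (ContinuousLinearMap.compL ℂ (L2n n) (L2n n) (L2n n) (fourierInvL n) ∘L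
    (ContinuousLinearMap.compL ℂ (L2n n) (L2n n) (L2n n)).flip (fourierL n)) ∘L bmul n

theorem fmul_apply (m : Rn n →ᵇ ℂ) (f : L2n n) :
    fmul n m f = fourierInvL n (bmul n m (fourierL n f)) := rfl

theorem norm_fmul_le (m : Rn n →ᵇ ℂ) : ‖fmul n m‖ ≤ ‖m‖ := by
  refine ContinuousLinearMap.opNorm_le_bound _ (norm_nonneg _) fun f ↦ ?_
  rw [fmul_apply, norm_fourierInvL_apply]
  refine ((bmul n m).le_opNorm _).trans ?_
  rw [norm_fourierL_apply]
  gcongr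
  exact norm_bmul_le m

theorem fmul_toL (m : Rn n →ᵇ ℂ) (hm : (m : Rn n → ℂ).HasTemperateGrowth) (u : 𝓢(Rn n, ℂ)) :
    fmul n m (toL n u) = toL n (SchwartzMap.fourierMultiplierCLM ℂ m u) := by
  have h1 : fourierL n (toL n u) = toL n (𝓕 u) := SchwartzMap.toLp_fourier_eq u
  have h2 : ∀ v : 𝓢(Rn n, ℂ), fourierInvL n (toL n v) = toL n (𝓕⁻ v) :=
    fun v ↦ SchwartzMap.toLp_fourierInv_eq v
  rw [fmul_apply, h1, bmul_toL m hm, h2]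
  rfl

theorem toTempered_fmul (m : Rn n →ᵇ ℂ) (hm : (m : Rn n → ℂ).HasTemperateGrowth) (f : L2n n) :
    Lp.toTemperedDistributionCLM ℂ volume 2 (fmul n m f) =
      TemperedDistribution.fourierMultiplierCLM ℂ m
        (Lp.toTemperedDistributionCLM ℂ volume 2 f) := by
  have h1 : 𝓕 (Lp.toTemperedDistributionCLM ℂ volume 2 f) =
      Lp.toTemperedDistributionCLM ℂ volume 2 (fourierL n f) :=
    Lp.fourier_toTemperedDistribution_eq f
  have h2 : ∀ g : L2n n, 𝓕⁻ (Lp.toTemperedDistributionCLM ℂ volume 2 g) =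
      Lp.toTemperedDistributionCLM ℂ volume 2 (fourierInvL n g) :=
    fun g ↦ Lp.fourierInv_toTemperedDistribution_eq g
  rw [TemperedDistribution.fourierMultiplierCLM_apply, h1, ← toTempered_bmul m hm, h2]
  rfl

/-- The weight `⟨x⟩^{-σ}` as a bounded continuous function, for `σ ≥ 0`. -/
def rho (n : ℕ) {σ : ℝ} (hσ : 0 ≤ σ) : Rn n →ᵇ ℂ :=
  BoundedContinuousFunction.ofNormedAddCommGroup (fun x ↦ ((jap n (-σ) x : ℝ) : ℂ))
    (Complex.continuous_ofReal.comp (hasTemperateGrowth_jap (-σ)).1.continuous) 1 (fun x ↦ by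
      rw [Complex.norm_real, Real.norm_of_nonneg (jap_pos _ x).le, ← jap_zero x]
      exact jap_mono (by linarith) x)

theorem rho_coe {σ : ℝ} (hσ : 0 ≤ σ) :
    (rho n hσ : Rn n → ℂ) = fun x ↦ ((jap n (-σ) x : ℝ) : ℂ) := rfl

theorem hasTemperateGrowth_rho {σ : ℝ} (hσ : 0 ≤ σ) :
    (rho n hσ : Rn n → ℂ).HasTemperateGrowth := by
  rw [rho_coe]; fun_prop

theorem norm_rho_le {σ : ℝ} (hσ : 0 ≤ σ) : ‖rho n hσ‖ ≤ 1 :=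
  BoundedContinuousFunction.norm_ofNormedAddCommGroup_le _ zero_le_one _

/-- The Fourier multiplier with symbol `m`, multiplied by `⟨x⟩^{-σ}` on both sides. -/
def sandwich (n : ℕ) {σ : ℝ} (hσ : 0 ≤ σ) : (Rn n →ᵇ ℂ) →L[ℂ] L2n n →L[ℂ] L2n n :=
  (ContinuousLinearMap.compL ℂ (L2n n) (L2n n) (L2n n) (bmul n (rho n hσ)) ∘L
    (ContinuousLinearMap.compL ℂ (L2n n) (L2n n) (L2n n)).flip (bmul n (rho n hσ))) ∘L fmul n

theorem sandwich_apply {σ : ℝ} (hσ : 0 ≤ σ) (m : Rn n →ᵇ ℂ) (f : L2n n) :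
    sandwich n hσ m f = bmul n (rho n hσ) (fmul n m (bmul n (rho n hσ) f)) := rfl

theorem norm_sandwich_le {σ : ℝ} (hσ : 0 ≤ σ) (m : Rn n →ᵇ ℂ) : ‖sandwich n hσ m‖ ≤ ‖m‖ := by
  have hρ : ∀ f : L2n n, ‖bmul n (rho n hσ) f‖ ≤ ‖f‖ := fun f ↦
    (((bmul n (rho n hσ)).le_opNorm f).trans (mul_le_mul_of_nonneg_right
      ((norm_bmul_le _).trans (norm_rho_le hσ)) (norm_nonneg _))).trans (one_mul _).le
  refine ContinuousLinearMap.opNorm_le_bound _ (norm_nonneg _) fun f ↦ ?_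
  rw [sandwich_apply]
  refine (hρ _).trans (((fmul n m).le_opNorm _).trans ?_)
  gcongr
  exacts [norm_fmul_le m, hρ f]

theorem bmul_rho_toL {σ : ℝ} (hσ : 0 ≤ σ) (u : 𝓢(Rn n, ℂ)) :
    bmul n (rho n hσ) (toL n u) = toL n (mulS (jap n (-σ)) u) :=
  bmul_toL _ (hasTemperateGrowth_rho hσ) u

/-- A weighted bound on Schwartz functions gives a bound for the operator norm. -/
theorem norm_sandwich_le_of_wnorm_le {σ : ℝ} (hσ : 0 ≤ σ) (m : Rn n →ᵇ ℂ)
    (hm : (m : Rn n → ℂ).HasTemperateGrowth) {C : ℝ} (hC : 0 ≤ C)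
    (h : ∀ F, wnorm (-σ) (SchwartzMap.fourierMultiplierCLM ℂ m F) ≤ C * wnorm σ F) :
    ‖sandwich n hσ m‖ ≤ C := by
  refine ContinuousLinearMap.opNorm_le_bound _ hC fun f ↦ ?_
  refine DenseRange.induction_on (p := fun f ↦ ‖sandwich n hσ m f‖ ≤ C * ‖f‖)
    (SchwartzMap.denseRange_toLpCLM (F := ℂ) (p := 2) (μ := (volume : Measure (Rn n)))
      ENNReal.ofNat_ne_top) f ?_ fun u ↦ ?_
  · exact isClosed_le (by fun_prop) (by fun_prop)
  · change ‖sandwich n hσ m (toL n u)‖ ≤ C * ‖toL n u‖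
    rw [sandwich_apply, bmul_rho_toL, fmul_toL m hm, bmul_rho_toL]
    -- Tested on F = ⟨x⟩^{-σ}u, whose norm with weight σ is the plain L² norm of u.
    have := h (mulS (jap n (-σ)) u)
    rwa [wnorm, wnorm, mulS_jap_mulS_jap, add_neg_cancel, mulS_jap_zero] at this

/-! ### Resolvent symbols and their analyticity in the sup norm -/

theorem isOpen_slit : IsOpen slit :=
  (Complex.isometry_ofReal.isClosedEmbedding.isClosedMap _ isClosed_Ici).isOpen_compl

/-- The symbol `⟨2πξ⟩^p` of `⟨∇⟩^p`. -/
def japF (n : ℕ) (p : ℝ) : Rn n → ℝ := fun ξ ↦ jap n p ((2 * π) • ξ)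

theorem norm_two_pi_smul_sq (ξ : Rn n) : ‖(2 * π) • ξ‖ ^ 2 = (2 * π) ^ 2 * ‖ξ‖ ^ 2 := by
  rw [norm_smul, mul_pow, Real.norm_eq_abs, sq_abs]

theorem japF_pos (p : ℝ) (ξ : Rn n) : 0 < japF n p ξ := jap_pos _ _

theorem japF_add (p q : ℝ) (ξ : Rn n) : japF n (p + q) ξ = japF n p ξ * japF n q ξ := jap_add _ _ _

theorem japF_two (ξ : Rn n) : japF n 2 ξ = 1 + (2 * π) ^ 2 * ‖ξ‖ ^ 2 := by
  rw [japF, jap_two, norm_two_pi_smul_sq]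

theorem one_le_japF {p : ℝ} (hp : 0 ≤ p) (ξ : Rn n) : 1 ≤ japF n p ξ := by
  rw [← jap_zero ((2 * π) • ξ)]
  exact jap_mono hp _

@[fun_prop]
theorem hasTemperateGrowth_japF (p : ℝ) : (japF n p).HasTemperateGrowth :=
  (hasTemperateGrowth_jap p).comp (((2 * π) • ContinuousLinearMap.id ℝ (Rn n)).hasTemperateGrowth)

/-- The symbol `⟨2πξ⟩^l / (|2πξ|² - ζ)` of `⟨∇⟩^l (-Δ - ζ)⁻¹`. -/
def resSymbol (n : ℕ) (l : ℝ) (ζ : ℂ) : Rn n → ℂ :=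
  fun ξ ↦ (japF n l ξ : ℂ) * (((2 * π) ^ 2 * ‖ξ‖ ^ 2 : ℝ) - ζ : ℂ)⁻¹

theorem hasTemperateGrowth_resSymbol (l : ℝ) {ζ : ℂ} (hζ : ζ ∈ slit) :
    (resSymbol n l ζ).HasTemperateGrowth := by
  have := hasTemperateGrowth_inv_symbol n hζ
  unfold resSymbol
  fun_prop

theorem exists_bound_resSymbol {l : ℝ} (hl : l ≤ 2) {ζ : ℂ} (hζ : ζ ∈ slit) :
    ∃ C, ∀ ξ, ‖resSymbol n l ζ ξ‖ ≤ C := by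
  obtain ⟨d, hd, hdist⟩ := exists_le_norm_sub hζ
  -- From P^l ≤ P² = (|2πξ|² - ζ) + (1 + ζ), divided by a denominator of modulus greater than d.
  refine ⟨1 + ‖1 + ζ‖ / d, fun ξ ↦ ?_⟩
  have hQ := hdist _ (by positivity : 0 ≤ (2 * π) ^ 2 * ‖ξ‖ ^ 2)
  have hQ0 : 0 < ‖(((2 * π) ^ 2 * ‖ξ‖ ^ 2 : ℝ) : ℂ) - ζ‖ := hd.trans hQ
  rw [resSymbol, norm_mul, norm_inv, Complex.norm_real, Real.norm_of_nonneg (japF_pos _ _).le,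
    ← div_eq_mul_inv, div_le_iff₀ hQ0]
  have h1 : japF n l ξ ≤ japF n 2 ξ := jap_mono hl _
  have h2 : japF n 2 ξ = ‖((((2 * π) ^ 2 * ‖ξ‖ ^ 2 : ℝ) : ℂ) - ζ) + (1 + ζ)‖ := by
    rw [← Real.norm_of_nonneg (japF_pos 2 ξ).le, ← Complex.norm_real, japF_two]
    congr 1
    push_cast
    ring
  have h3 := norm_add_le ((((2 * π) ^ 2 * ‖ξ‖ ^ 2 : ℝ) : ℂ) - ζ) (1 + ζ)
  have h4 : ‖1 + ζ‖ ≤ ‖1 + ζ‖ / d * ‖(((2 * π) ^ 2 * ‖ξ‖ ^ 2 : ℝ) : ℂ) - ζ‖ := by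
    rw [div_mul_eq_mul_div, le_div_iff₀ hd]
    gcongr
  linarith

open Classical in
/-- The symbol `⟨2πξ⟩^l / (|2πξ|² - ζ)` as a bounded continuous function, for `l ≤ 2` and `ζ` in
the slit plane. -/
def symB (n : ℕ) (l : ℝ) (ζ : ℂ) : Rn n →ᵇ ℂ :=
  if h : l ≤ 2 ∧ ζ ∈ slit then
    BoundedContinuousFunction.ofNormedAddCommGroup (resSymbol n l ζ)
      (hasTemperateGrowth_resSymbol l h.2).1.continuous _
      (exists_bound_resSymbol h.1 h.2).choose_spec
  else 0

theorem symB_coe {l : ℝ} (hl : l ≤ 2) {ζ : ℂ} (hζ : ζ ∈ slit) :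
    (symB n l ζ : Rn n → ℂ) = resSymbol n l ζ := by
  rw [symB, dif_pos ⟨hl, hζ⟩]
  rfl

theorem symB_apply {l : ℝ} (hl : l ≤ 2) {ζ : ℂ} (hζ : ζ ∈ slit) (ξ : Rn n) :
    symB n l ζ ξ = (japF n l ξ : ℂ) * (((2 * π) ^ 2 * ‖ξ‖ ^ 2 : ℝ) - ζ : ℂ)⁻¹ := by
  rw [symB_coe hl hζ, resSymbol]

theorem symB_zero_apply {ζ : ℂ} (hζ : ζ ∈ slit) (ξ : Rn n) :
    symB n 0 ζ ξ = (((2 * π) ^ 2 * ‖ξ‖ ^ 2 : ℝ) - ζ : ℂ)⁻¹ := by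
  rw [symB_apply zero_le_two hζ, japF, jap_zero, Complex.ofReal_one, one_mul]

/-- The first resolvent identity for symbols. -/
theorem symB_sub {l : ℝ} (hl : l ≤ 2) {ζ ζ' : ℂ} (hζ : ζ ∈ slit) (hζ' : ζ' ∈ slit) :
    symB n l ζ' - symB n l ζ = (ζ' - ζ) • (symB n 0 ζ' * symB n l ζ) := by
  ext ξ
  simp only [BoundedContinuousFunction.sub_apply, BoundedContinuousFunction.smul_apply,
    BoundedContinuousFunction.mul_apply, symB_zero_apply hζ', symB_apply hl hζ,
    symB_apply hl hζ', smul_eq_mul]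
  have h1 := symbol_ne_zero hζ ξ
  have h2 := symbol_ne_zero hζ' ξ
  generalize (((2 * π) ^ 2 * ‖ξ‖ ^ 2 : ℝ) : ℂ) = a at *
  field_simp
  ring

/-- By the resolvent identity it suffices to bound Q(ζ') near ζ. If ζ is farther than d from the
half-line, then ζ' within d/2 of ζ keeps the denominator above d/2. -/
theorem continuousAt_symB_zero {ζ : ℂ} (hζ : ζ ∈ slit) : ContinuousAt (symB n 0) ζ := by
  obtain ⟨d, hd, hdist⟩ := exists_le_norm_sub hζ
  rw [ContinuousAt, tendsto_iff_norm_sub_tendsto_zero]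
  have hlim : Tendsto (fun ζ' : ℂ ↦ ‖ζ' - ζ‖ * (2 / d * ‖symB n 0 ζ‖)) (𝓝 ζ) (𝓝 0) := by
    have : Tendsto (fun ζ' : ℂ ↦ ‖ζ' - ζ‖ * (2 / d * ‖symB n 0 ζ‖)) (𝓝 ζ)
        (𝓝 (‖ζ - ζ‖ * (2 / d * ‖symB n 0 ζ‖))) := Continuous.tendsto (by fun_prop) ζ
    simpa using this
  refine squeeze_zero' (.of_forall fun _ ↦ norm_nonneg _) ?_ hlim
  filter_upwards [isOpen_slit.mem_nhds hζ, Metric.ball_mem_nhds ζ (half_pos hd)] with ζ' hζ' hb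
  rw [symB_sub zero_le_two hζ hζ', norm_smul]
  gcongr
  refine (norm_mul_le _ _).trans ?_
  gcongr
  refine (BoundedContinuousFunction.norm_le (by positivity)).mpr fun ξ ↦ ?_
  rw [symB_zero_apply hζ', norm_inv, show (2 / d : ℝ) = (d / 2)⁻¹ by rw [inv_div]]
  gcongr
  have h1 := hdist _ (by positivity : 0 ≤ (2 * π) ^ 2 * ‖ξ‖ ^ 2)
  rw [Metric.mem_ball, dist_eq_norm] at hb
  have h2 := norm_sub_norm_le ((((2 * π) ^ 2 * ‖ξ‖ ^ 2 : ℝ) : ℂ) - ζ) (ζ' - ζ)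
  rw [sub_sub_sub_cancel_right] at h2
  linarith

/-- By the resolvent identity the difference quotient is exactly Q(ζ')P^l Q(ζ), so continuity of Q
suffices. -/
theorem hasDerivAt_symB {l : ℝ} (hl : l ≤ 2) {ζ : ℂ} (hζ : ζ ∈ slit) :
    HasDerivAt (symB n l) (symB n 0 ζ * symB n l ζ) ζ := by
  rw [hasDerivAt_iff_tendsto_slope]
  have h : Tendsto (fun ζ' ↦ symB n 0 ζ' * symB n l ζ) (𝓝[≠] ζ)
      (𝓝 (symB n 0 ζ * symB n l ζ)) :=
    ((continuousAt_symB_zero hζ).tendsto.mul_const _).mono_left nhdsWithin_le_nhds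
  refine h.congr' ?_
  filter_upwards [self_mem_nhdsWithin, nhdsWithin_le_nhds (isOpen_slit.mem_nhds hζ)]
    with ζ' hne hζ'
  rw [slope_def_module, symB_sub hl hζ hζ', smul_smul, inv_mul_cancel₀ (sub_ne_zero.mpr hne),
    one_smul]

theorem hasDerivAt_symB_pow {l : ℝ} (hl : l ≤ 2) (j : ℕ) {ζ : ℂ} (hζ : ζ ∈ slit) :
    HasDerivAt (fun ζ ↦ symB n 0 ζ ^ j * symB n l ζ)
      (((j : ℂ) + 1) • (symB n 0 ζ ^ (j + 1) * symB n l ζ)) ζ := by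
  induction j with
  | zero => simpa using hasDerivAt_symB hl hζ
  | succ j ih =>
    have h := (hasDerivAt_symB (n := n) zero_le_two hζ).mul ih
    have e : (fun ζ ↦ symB n 0 ζ ^ (j + 1) * symB n l ζ) =
        symB n 0 * fun ζ ↦ symB n 0 ζ ^ j * symB n l ζ := by
      ext1 z
      rw [Pi.mul_apply, pow_succ']
      ring
    rw [e]
    refine h.congr_deriv ?_
    push_cast
    rw [mul_smul_comm]
    have e1 : symB n 0 ζ * symB n 0 ζ * (symB n 0 ζ ^ j * symB n l ζ) =
      symB n 0 ζ ^ (j + 1 + 1) * symB n l ζ := by ring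
    have e2 : symB n 0 ζ * (symB n 0 ζ ^ (j + 1) * symB n l ζ) =
      symB n 0 ζ ^ (j + 1 + 1) * symB n l ζ := by ring
    rw [e1, e2]
    module

theorem analyticOnNhd_symB {l : ℝ} (hl : l ≤ 2) : AnalyticOnNhd ℂ (symB n l) slit :=
  DifferentiableOn.analyticOnNhd
    (fun _ hζ ↦ (hasDerivAt_symB hl hζ).differentiableAt.differentiableWithinAt) isOpen_slit

/-- A continuous linear map commutes with differentiation, so the derivatives are those of the
symbol, with the factors 1, 2, …, k accumulating to k!. The slit plane is open, which lets the
formula for k be differentiated again. -/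
theorem iteratedDeriv_comp_symB {V : Type*} [NormedAddCommGroup V] [NormedSpace ℂ V]
    (Ψ : (Rn n →ᵇ ℂ) →L[ℂ] V) {l : ℝ} (hl : l ≤ 2) (k : ℕ) :
    ∀ ζ ∈ slit, iteratedDeriv k (fun ζ ↦ Ψ (symB n l ζ)) ζ =
      (k.factorial : ℂ) • Ψ (symB n 0 ζ ^ k * symB n l ζ) := by
  induction k with
  | zero => intro ζ _; simp
  | succ k ih =>
    intro ζ hζ
    rw [iteratedDeriv_succ]
    have he : iteratedDeriv k (fun ζ ↦ Ψ (symB n l ζ)) =ᶠ[𝓝 ζ]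
        fun ζ ↦ (k.factorial : ℂ) • Ψ (symB n 0 ζ ^ k * symB n l ζ) :=
      Filter.eventually_of_mem (isOpen_slit.mem_nhds hζ) ih
    rw [he.deriv_eq]
    have hd := ((Ψ.hasFDerivAt.comp_hasDerivAt ζ (hasDerivAt_symB_pow (n := n) hl k hζ))).const_smul
      (k.factorial : ℂ)
    refine hd.deriv.trans ?_
    rw [map_smul, smul_smul, Nat.factorial_succ]
    push_cast
    ring_nf

theorem coe_symB_zero_pow {ζ : ℂ} (hζ : ζ ∈ slit) (j : ℕ) :
    ((symB n 0 ζ ^ j : Rn n →ᵇ ℂ) : Rn n → ℂ) =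
      fun ξ ↦ (((2 * π) ^ 2 * ‖ξ‖ ^ 2 : ℝ) - ζ : ℂ)⁻¹ ^ j := by
  ext ξ
  rw [BoundedContinuousFunction.pow_apply, symB_zero_apply hζ]

theorem fourierMultiplier_inv_symbol_pow {ζ : ℂ} (hζ : ζ ∈ slit) (j : ℕ) :
    SchwartzMap.fourierMultiplierCLM ℂ
      (fun ξ : Rn n ↦ (((2 * π) ^ 2 * ‖ξ‖ ^ 2 : ℝ) - ζ : ℂ)⁻¹ ^ j) = resolventS n ζ ^ j := by
  have hq := hasTemperateGrowth_inv_symbol n hζ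
  induction j with
  | zero =>
    simp only [pow_zero]
    rw [SchwartzMap.fourierMultiplierCLM_const, one_smul]
    rfl
  | succ j ih =>
    rw [pow_succ (resolventS n ζ) j, ← ih, ContinuousLinearMap.mul_def, resolventS,
      SchwartzMap.fourierMultiplierCLM_compL_fourierMultiplierCLM (by fun_prop) hq]
    rfl

/-! ### Orders of growth at infinity and algebra of symbols -/

/-- The neighbourhoods of infinity in the slit plane. -/
def atInfty : Filter ℂ := Bornology.cobounded ℂ ⊓ 𝓟 slit

theorem eventually_atInfty (T : ℝ) : ∀ᶠ ζ in atInfty, ζ ∈ slit ∧ T ≤ ‖ζ‖ := by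
  have h1 : ∀ᶠ ζ in Bornology.cobounded ℂ, T ≤ ‖ζ‖ :=
    tendsto_norm_cobounded_atTop.eventually_ge_atTop T
  exact ((eventually_principal.mpr fun _ h ↦ h).filter_mono inf_le_right).and
    (h1.filter_mono inf_le_left)

theorem rpow_mul_atInfty (a b : ℝ) :
    (fun ζ : ℂ ↦ ‖ζ‖ ^ a * ‖ζ‖ ^ b) =ᶠ[atInfty] fun ζ ↦ ‖ζ‖ ^ (a + b) := by
  filter_upwards [eventually_atInfty 1] with ζ hζ
  rw [Real.rpow_add (by linarith [hζ.2])]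

theorem rpow_isBigO_atInfty {a b : ℝ} (h : a ≤ b) :
    (fun ζ : ℂ ↦ ‖ζ‖ ^ a) =O[atInfty] fun ζ ↦ ‖ζ‖ ^ b := by
  refine Asymptotics.IsBigO.of_bound 1 ?_
  filter_upwards [eventually_atInfty 1] with ζ hζ
  rw [Real.norm_of_nonneg (by positivity), Real.norm_of_nonneg (by positivity), one_mul]
  exact Real.rpow_le_rpow_of_exponent_le hζ.2 h

theorem IsBigO.smul_atInfty {V : Type*} [NormedAddCommGroup V] [NormedSpace ℂ V] {c : ℂ → ℂ}
    {f : ℂ → V} {a b d : ℝ} (hc : c =O[atInfty] fun ζ ↦ ‖ζ‖ ^ a)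
    (hf : f =O[atInfty] fun ζ ↦ ‖ζ‖ ^ b) (hd : a + b ≤ d) :
    (fun ζ ↦ c ζ • f ζ) =O[atInfty] fun ζ ↦ ‖ζ‖ ^ d := by
  have h := hc.smul hf
  simp only [smul_eq_mul] at h
  exact (h.trans_eventuallyEq (rpow_mul_atInfty a b)).trans (rpow_isBigO_atInfty hd)

theorem exists_sqrt_re_nonneg (z : ℂ) : ∃ w : ℂ, w ^ 2 = z ∧ 0 ≤ w.re := by
  obtain ⟨w, hw⟩ := IsAlgClosed.exists_pow_nat_eq z two_pos
  rcases le_total 0 w.re with h | h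
  · exact ⟨w, hw, h⟩
  · exact ⟨-w, by rw [neg_sq, hw], by simpa using h⟩

/-- A square root of `1 + ζ` with nonnegative real part. -/
def root (ζ : ℂ) : ℂ := (exists_sqrt_re_nonneg (1 + ζ)).choose

theorem root_sq (ζ : ℂ) : root ζ ^ 2 = 1 + ζ := (exists_sqrt_re_nonneg (1 + ζ)).choose_spec.1

theorem root_re (ζ : ℂ) : 0 ≤ (root ζ).re := (exists_sqrt_re_nonneg (1 + ζ)).choose_spec.2

theorem one_add_isBigO : (fun ζ : ℂ ↦ 1 + ζ) =O[atInfty] fun ζ ↦ ‖ζ‖ ^ (1 : ℝ) := by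
  refine Asymptotics.IsBigO.of_bound 2 ?_
  filter_upwards [eventually_atInfty 1] with ζ hζ
  have := norm_add_le (1 : ℂ) ζ
  rw [norm_one] at this
  rw [Real.rpow_one, norm_norm]
  linarith [hζ.2]

theorem half_norm_le {ζ : ℂ} (h : 2 ≤ ‖ζ‖) : ‖ζ‖ / 2 ≤ ‖1 + ζ‖ := by
  have := norm_sub_le (1 + ζ) 1
  rw [add_sub_cancel_left, norm_one] at this
  linarith

theorem inv_one_add_isBigO : (fun ζ : ℂ ↦ (1 + ζ)⁻¹) =O[atInfty] fun ζ ↦ ‖ζ‖ ^ (-1 : ℝ) := by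
  refine Asymptotics.IsBigO.of_bound 2 ?_
  filter_upwards [eventually_atInfty 2] with ζ hζ
  have h := half_norm_le hζ.2
  rw [norm_inv, Real.norm_of_nonneg (by positivity), Real.rpow_neg_one]
  have h0 : 0 < ‖ζ‖ / 2 := by linarith [hζ.2]
  refine (inv_anti₀ h0 h).trans (le_of_eq ?_)
  rw [inv_div, div_eq_mul_inv]

theorem norm_root (ζ : ℂ) : ‖root ζ‖ = ‖1 + ζ‖ ^ (1 / 2 : ℝ) := by
  rw [← root_sq, norm_pow, ← Real.sqrt_eq_rpow, Real.sqrt_sq (norm_nonneg _)]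

theorem root_isBigO : root =O[atInfty] fun ζ ↦ ‖ζ‖ ^ (1 / 2 : ℝ) := by
  have h := one_add_isBigO.norm_left.rpow (r := 1 / 2) (by norm_num)
    (.of_forall fun ζ ↦ by positivity)
  refine Asymptotics.IsBigO.of_norm_left ((h.congr_left fun ζ ↦ (norm_root ζ).symm).congr_right
    fun ζ ↦ ?_)
  rw [Real.rpow_one]

theorem inv_root_isBigO : (fun ζ ↦ (root ζ)⁻¹) =O[atInfty] fun ζ ↦ ‖ζ‖ ^ (-(1 / 2) : ℝ) := by
  have h := inv_one_add_isBigO.norm_left.rpow (r := 1 / 2) (by norm_num)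
    (.of_forall fun ζ ↦ by positivity)
  refine Asymptotics.IsBigO.of_norm_left ((h.congr_left fun ζ ↦ ?_).congr_right fun ζ ↦ ?_)
  · rw [norm_inv, norm_inv, norm_root, Real.inv_rpow (norm_nonneg _)]
  · rw [← Real.rpow_mul (norm_nonneg _)]
    norm_num

/-- Adding a positive number to w with Re w ≥ 0 moves it away from the origin. This is why the root
is taken with nonnegative real part; no continuity of the root in ζ is needed. -/
theorem norm_japF_add_ge {w : ℂ} (hw : 0 ≤ w.re) (ξ : Rn n) :
    1 ≤ ‖(japF n 1 ξ : ℂ) + w‖ ∧ ‖w‖ ≤ ‖(japF n 1 ξ : ℂ) + w‖ := by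
  have hP := one_le_japF (n := n) zero_le_one ξ
  constructor
  · refine le_trans ?_ (Complex.re_le_norm _)
    rw [Complex.add_re, Complex.ofReal_re]
    linarith
  · refine le_of_sq_le_sq ?_ (norm_nonneg _)
    rw [Complex.sq_norm, Complex.sq_norm, Complex.normSq_apply, Complex.normSq_apply]
    simp only [Complex.add_re, Complex.add_im, Complex.ofReal_re, Complex.ofReal_im, zero_add]
    nlinarith

/-- The symbol `(⟨2πξ⟩ + w)⁻¹`, where `w² = 1 + ζ`. -/
def symE (n : ℕ) (ζ : ℂ) : Rn n →ᵇ ℂ :=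
  BoundedContinuousFunction.ofNormedAddCommGroup (fun ξ ↦ ((japF n 1 ξ : ℂ) + root ζ)⁻¹)
    (Continuous.inv₀ ((Complex.continuous_ofReal.comp
      (hasTemperateGrowth_japF 1).1.continuous).add continuous_const) fun ξ h ↦ by
        have := (norm_japF_add_ge (n := n) (root_re ζ) ξ).1
        change (japF n 1 ξ : ℂ) + root ζ = 0 at h
        rw [h, norm_zero] at this
        linarith) 1
    (fun ξ ↦ by
      rw [norm_inv]
      exact inv_le_one_of_one_le₀ (norm_japF_add_ge (root_re ζ) ξ).1)

theorem symE_apply (ζ : ℂ) (ξ : Rn n) : symE n ζ ξ = ((japF n 1 ξ : ℂ) + root ζ)⁻¹ := rfl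

theorem japF_add_root_ne_zero (ζ : ℂ) (ξ : Rn n) : (japF n 1 ξ : ℂ) + root ζ ≠ 0 := fun h ↦ by
  have := (norm_japF_add_ge (n := n) (root_re ζ) ξ).1
  rw [h, norm_zero] at this
  linarith

theorem symE_isBigO : (symE n) =O[atInfty] fun ζ ↦ ‖ζ‖ ^ (-(1 / 2) : ℝ) := by
  refine Asymptotics.IsBigO.trans (Asymptotics.IsBigO.of_bound 1 ?_) inv_root_isBigO
  filter_upwards [eventually_atInfty 2] with ζ hζ
  rw [one_mul]
  refine (BoundedContinuousFunction.norm_le (norm_nonneg _)).mpr fun ξ ↦ ?_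
  have h0 : 0 < ‖root ζ‖ := by
    rw [norm_root]
    have := half_norm_le hζ.2
    have : 0 < ‖1 + ζ‖ := by linarith [hζ.2]
    positivity
  rw [symE_apply, norm_inv, norm_inv]
  exact inv_anti₀ h0 (norm_japF_add_ge (root_re ζ) ξ).2

theorem symbol_eq_mul (ζ : ℂ) (ξ : Rn n) : (((2 * π) ^ 2 * ‖ξ‖ ^ 2 : ℝ) - ζ : ℂ) =
    ((japF n 1 ξ : ℂ) - root ζ) * ((japF n 1 ξ : ℂ) + root ζ) := by
  have h1 : japF n 1 ξ * japF n 1 ξ = 1 + (2 * π) ^ 2 * ‖ξ‖ ^ 2 := by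
    rw [← japF_add, ← japF_two]; norm_num
  have h2 : (japF n 1 ξ : ℂ) * japF n 1 ξ = 1 + ((2 * π) ^ 2 * ‖ξ‖ ^ 2 : ℝ) := by
    rw [← Complex.ofReal_mul, h1]; push_cast; ring
  linear_combination -h2 + root_sq ζ

theorem japF_sub_root_ne_zero {ζ : ℂ} (hζ : ζ ∈ slit) (ξ : Rn n) :
    (japF n 1 ξ : ℂ) - root ζ ≠ 0 := fun h ↦
  symbol_ne_zero hζ ξ (by rw [symbol_eq_mul, h, zero_mul])

/-- Partial fractions: 2w = (P + w) - (P - w), divided by (P - w)(P + w)². -/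
theorem two_root_smul_symB_mul_symE {ζ : ℂ} (hζ : ζ ∈ slit) :
    (2 * root ζ) • (symB n 0 ζ * symE n ζ) = symB n 0 ζ - symE n ζ * symE n ζ := by
  ext ξ
  simp only [BoundedContinuousFunction.smul_apply, BoundedContinuousFunction.mul_apply,
    BoundedContinuousFunction.sub_apply, symB_zero_apply hζ, symE_apply, symbol_eq_mul, smul_eq_mul]
  have h1 := japF_add_root_ne_zero (n := n) ζ ξ
  have h2 := japF_sub_root_ne_zero (n := n) hζ ξ
  field_simp
  ring

/-- Write P = w + (P - w) in the numerator over (P - w)(P + w). -/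
theorem symB_one_eq {ζ : ℂ} (hζ : ζ ∈ slit) :
    symB n 1 ζ = root ζ • symB n 0 ζ + symE n ζ := by
  ext ξ
  simp only [BoundedContinuousFunction.smul_apply, BoundedContinuousFunction.add_apply,
    symB_apply one_le_two hζ, symB_zero_apply hζ, symE_apply, symbol_eq_mul, smul_eq_mul]
  have h1 := japF_add_root_ne_zero (n := n) ζ ξ
  have h2 := japF_sub_root_ne_zero (n := n) hζ ξ
  field_simp
  ring

theorem symB_two_eq {ζ : ℂ} (hζ : ζ ∈ slit) :
    symB n 2 ζ = 1 + (1 + ζ) • symB n 0 ζ := by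
  ext ξ
  simp only [BoundedContinuousFunction.smul_apply, BoundedContinuousFunction.add_apply,
    symB_apply le_rfl hζ, symB_zero_apply hζ, smul_eq_mul, BoundedContinuousFunction.coe_one,
    Pi.one_apply, japF_two]
  have h1 := symbol_ne_zero hζ ξ
  rw [Complex.ofReal_add, Complex.ofReal_one]
  generalize (((2 * π) ^ 2 * ‖ξ‖ ^ 2 : ℝ) : ℂ) = a at *
  field_simp
  ring

/-- The symbol `⟨2πξ⟩⁻¹`. -/
def symPinv (n : ℕ) : Rn n →ᵇ ℂ :=
  BoundedContinuousFunction.ofNormedAddCommGroup (fun ξ ↦ (japF n (-1) ξ : ℂ))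
    (Complex.continuous_ofReal.comp (hasTemperateGrowth_japF (-1)).1.continuous) 1 (fun ξ ↦ by
      rw [Complex.norm_real, Real.norm_of_nonneg (japF_pos _ _).le]
      exact (jap_mono (by norm_num : (-1 : ℝ) ≤ 0) _).trans (jap_zero _).le)

theorem symPinv_apply (ξ : Rn n) : symPinv n ξ = (japF n (-1) ξ : ℂ) := rfl

theorem symB_neg_one_eq {ζ : ℂ} (hζ : ζ ∈ slit) :
    symB n (-1) ζ = symB n 0 ζ * symPinv n := by
  ext ξ
  rw [BoundedContinuousFunction.mul_apply, symB_apply (by norm_num) hζ, symB_zero_apply hζ,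
    symPinv_apply, mul_comm]

theorem one_add_smul_symB_neg_one {ζ : ℂ} (hζ : ζ ∈ slit) :
    (1 + ζ) • symB n (-1) ζ = symB n 1 ζ - symPinv n := by
  ext ξ
  simp only [BoundedContinuousFunction.smul_apply, BoundedContinuousFunction.sub_apply,
    symB_apply one_le_two hζ, symB_apply (by norm_num : (-1 : ℝ) ≤ 2) hζ, symPinv_apply,
    smul_eq_mul]
  have h1 := symbol_ne_zero hζ ξ
  have h2 : (japF n 1 ξ : ℂ) = japF n (-1) ξ * (1 + ((2 * π) ^ 2 * ‖ξ‖ ^ 2 : ℝ)) := by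
    rw [show (1 : ℝ) = -1 + 2 by norm_num, japF_add, japF_two]
    push_cast
    norm_num
  rw [h2]
  generalize (((2 * π) ^ 2 * ‖ξ‖ ^ 2 : ℝ) : ℂ) = a at *
  field_simp
  ring

/-! ### Bounds for the sandwiched multipliers at high energy -/

section bounds

variable {σ : ℝ} (hσ : 0 ≤ σ)

theorem sandwich_isBigO_of_isBigO {m : ℂ → (Rn n →ᵇ ℂ)} {g : ℂ → ℝ} (h : m =O[atInfty] g) :
    (fun ζ ↦ sandwich n hσ (m ζ)) =O[atInfty] g :=
  (Asymptotics.IsBigO.of_norm_le fun ζ ↦ norm_sandwich_le hσ (m ζ)).trans h.norm_left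

theorem sandwich_symB_pow_isBigO (j : ℕ) (hj : (j : ℝ) < σ + 1 / 2) (hj0 : 1 ≤ j) :
    (fun ζ ↦ sandwich n hσ (symB n 0 ζ ^ j)) =O[atInfty] fun ζ ↦ ‖ζ‖ ^ (-(j / 2) : ℝ) := by
  -- The estimate for the power i + 1 asks for σ > i + 1/2, which is j < σ + 1/2.
  obtain ⟨i, rfl⟩ := Nat.exists_eq_add_of_le' hj0
  push_cast at hj
  obtain ⟨C, T, hC, hT, h⟩ := resolventS_pow_estimate n i σ (by linarith)
  refine Asymptotics.IsBigO.of_bound C ?_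
  filter_upwards [eventually_atInfty (T ^ 2)] with ζ hζ
  have hq := hasTemperateGrowth_inv_symbol n hζ.1
  have ht : T ≤ √‖ζ‖ := Real.le_sqrt_of_sq_le hζ.2
  have ht0 : 0 < √‖ζ‖ := by linarith
  have he : ‖ζ‖ ^ (-((i + 1 : ℕ) / 2) : ℝ) = (√‖ζ‖ ^ (i + 1))⁻¹ := by
    rw [Real.sqrt_eq_rpow, ← Real.rpow_natCast, ← Real.rpow_mul (norm_nonneg _),
      ← Real.rpow_neg (norm_nonneg _)]
    ring_nf
  rw [he, Real.norm_of_nonneg (by positivity)]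
  refine norm_sandwich_le_of_wnorm_le hσ _ ?_ (by positivity) fun F ↦ ?_
  · rw [coe_symB_zero_pow hζ.1]
    fun_prop
  · rw [coe_symB_zero_pow hζ.1, fourierMultiplier_inv_symbol_pow hζ.1, mul_right_comm,
      ← div_eq_mul_inv, le_div_iff₀ (by positivity), mul_comm]
    exact (h ζ hζ.1 ht F).1

/-- E does not commute with the weights, so its sup norm cannot simply be multiplied with the
weighted bound for Q^j. Instead Q^{j+1}E^{m+1} = (2w)⁻¹(Q^{j+1}E^m - Q^jE^{m+2}) lowers m or j and
gains w⁻¹. The recursion ends at pure powers of Q, where the weights are needed, or of E, where the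
sup norm suffices. -/
theorem sandwich_symB_pow_mul_symE_pow_isBigO (j : ℕ) (hj : (j : ℝ) < σ + 1 / 2) (m : ℕ) :
    (fun ζ ↦ sandwich n hσ (symB n 0 ζ ^ j * symE n ζ ^ m)) =O[atInfty]
      fun ζ ↦ ‖ζ‖ ^ (-((j + m : ℝ) / 2)) := by
  induction j generalizing m with
  | zero =>
    refine sandwich_isBigO_of_isBigO hσ ?_
    simp only [pow_zero, one_mul]
    have h := (symE_isBigO (n := n)).norm_left.pow m
    refine (Asymptotics.IsBigO.trans (Asymptotics.IsBigO.of_bound 1 (.of_forall fun ζ ↦ ?_))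
      h).congr_right fun ζ ↦ ?_
    · rw [one_mul, Real.norm_of_nonneg (by positivity)]
      exact norm_pow_le _ _
    · rw [← Real.rpow_natCast, ← Real.rpow_mul (norm_nonneg _)]
      ring_nf
  | succ j ihj =>
    have hj' : (j : ℝ) < σ + 1 / 2 := by push_cast at hj; linarith
    induction m with
    | zero =>
      simp only [pow_zero, mul_one]
      refine (sandwich_symB_pow_isBigO hσ (j + 1) hj (by omega)).congr_right fun ζ ↦ ?_
      simp
    | succ m ihm =>
      have h1 := ihm.sub ((ihj hj' (m + 2)).trans (rpow_isBigO_atInfty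
        (b := -(((j + 1 : ℕ) + m : ℝ) / 2)) (by push_cast; linarith)))
      have h2 := IsBigO.smul_atInfty (d := -(((j + 1 : ℕ) + (m + 1 : ℕ) : ℝ) / 2))
        (inv_root_isBigO.const_mul_left (1 / 2)) h1 (by push_cast; linarith)
      refine h2.congr' ?_ EventuallyEq.rfl
      filter_upwards [eventually_atInfty 2] with ζ hζ
      have hr : root ζ ≠ 0 := by
        intro h0
        have h3 := half_norm_le hζ.2
        rw [← root_sq, h0] at h3
        norm_num at h3
        linarith [hζ.2]
      have hrel := two_root_smul_symB_mul_symE (n := n) hζ.1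
      rw [← map_sub, ← map_smul]
      congr 1
      have h4 : symB n 0 ζ ^ (j + 1) * symE n ζ ^ m - symB n 0 ζ ^ j * symE n ζ ^ (m + 2) =
          (2 * root ζ) • (symB n 0 ζ ^ (j + 1) * symE n ζ ^ (m + 1)) := by
        calc _ = symB n 0 ζ ^ j * symE n ζ ^ m * (symB n 0 ζ - symE n ζ * symE n ζ) := by ring
          _ = _ := by
            rw [← hrel, mul_smul_comm]
            congr 1
            ring
      rw [h4, smul_smul]
      have h5 : 1 / 2 * (root ζ)⁻¹ * (2 * root ζ) = 1 := by field_simp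
      rw [h5, one_smul]

theorem sandwich_pow_mul_symB_zero (k : ℕ) (hk : 1 / 2 + (k : ℝ) < σ) :
    (fun ζ ↦ sandwich n hσ (symB n 0 ζ ^ k * symB n 0 ζ)) =O[atInfty]
      fun ζ ↦ ‖ζ‖ ^ (-((1 + k : ℝ) / 2)) := by
  refine ((sandwich_symB_pow_isBigO (n := n) hσ (k + 1) (by push_cast; linarith)
    (by omega)).congr_left fun ζ ↦ ?_).congr_right fun ζ ↦ ?_
  · rw [pow_succ]
  · push_cast
    rw [add_comm]

theorem sandwich_pow_mul_symB_one (k : ℕ) (hk : 1 / 2 + (k : ℝ) < σ) :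
    (fun ζ ↦ sandwich n hσ (symB n 0 ζ ^ k * symB n 1 ζ)) =O[atInfty]
      fun ζ ↦ ‖ζ‖ ^ (-((k : ℝ) / 2)) := by
  have h1 := IsBigO.smul_atInfty (d := -((k : ℝ) / 2)) root_isBigO
    (sandwich_pow_mul_symB_zero (n := n) hσ k hk) (by linarith)
  have h2 := (sandwich_symB_pow_mul_symE_pow_isBigO (n := n) hσ k (by linarith) 1).trans
    (rpow_isBigO_atInfty (b := -((k : ℝ) / 2)) (by push_cast; linarith))
  refine (h1.add h2).congr' ?_ EventuallyEq.rfl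
  filter_upwards [eventually_atInfty 1] with ζ hζ
  rw [symB_one_eq hζ.1, ← map_smul, ← map_add, pow_one, mul_add, mul_smul_comm]

theorem sandwich_pow_mul_symB_neg_one (k : ℕ) (hk : 1 / 2 + (k : ℝ) < σ) :
    (fun ζ ↦ sandwich n hσ (symB n 0 ζ ^ k * symB n (-1) ζ)) =O[atInfty]
      fun ζ ↦ ‖ζ‖ ^ (-((2 + k : ℝ) / 2)) := by
  -- Here too P⁻¹ cannot be split off across the weight. Since Q^{k+1}P⁻¹ = (1+ζ)⁻¹(Q^k PQ - Q^k
  -- P⁻¹), induction on k applies.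
  have hP : (fun ζ ↦ sandwich n hσ (symB n 0 ζ ^ k * symPinv n)) =O[atInfty]
      fun ζ ↦ ‖ζ‖ ^ (-((k : ℝ) / 2)) := by
    induction k with
    | zero =>
      simp only [pow_zero, one_mul, Nat.cast_zero, zero_div, neg_zero, Real.rpow_zero]
      exact Asymptotics.isBigO_const_const _ one_ne_zero _
    | succ k ih =>
      have hk' : 1 / 2 + (k : ℝ) < σ := by push_cast at hk; linarith
      have h1 := IsBigO.smul_atInfty (d := -(((k + 1 : ℕ) : ℝ) / 2)) inv_one_add_isBigO
        ((sandwich_pow_mul_symB_one (n := n) hσ k hk').sub (ih hk')) (by push_cast; linarith)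
      refine h1.congr' ?_ EventuallyEq.rfl
      filter_upwards [eventually_atInfty 2] with ζ hζ
      have h0 : 1 + ζ ≠ 0 := norm_pos_iff.mp (by linarith [half_norm_le hζ.2, hζ.2])
      rw [← map_sub, ← map_smul, ← mul_sub, ← one_add_smul_symB_neg_one hζ.1, mul_smul_comm,
        smul_smul, inv_mul_cancel₀ h0, one_smul, symB_neg_one_eq hζ.1, ← mul_assoc, pow_succ]
  have h1 := IsBigO.smul_atInfty (d := -((2 + k : ℝ) / 2)) inv_one_add_isBigO
    ((sandwich_pow_mul_symB_one (n := n) hσ k hk).sub hP) (by linarith)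
  refine h1.congr' ?_ EventuallyEq.rfl
  filter_upwards [eventually_atInfty 2] with ζ hζ
  have h0 : 1 + ζ ≠ 0 := norm_pos_iff.mp (by linarith [half_norm_le hζ.2, hζ.2])
  rw [← map_sub, ← map_smul, ← mul_sub, ← one_add_smul_symB_neg_one hζ.1, mul_smul_comm,
    smul_smul, inv_mul_cancel₀ h0, one_smul]

theorem sandwich_symB_two (h : 1 / 2 < σ) :
    (fun ζ ↦ sandwich n hσ (symB n 2 ζ)) =O[atInfty] fun ζ ↦ ‖ζ‖ ^ (1 / 2 : ℝ) := by
  have h1 := IsBigO.smul_atInfty (d := 1 / 2) one_add_isBigO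
    (sandwich_pow_mul_symB_zero (n := n) hσ 0 (by simpa using h)) (by norm_num)
  have h2 : (fun _ : ℂ ↦ sandwich n hσ 1) =O[atInfty] fun ζ ↦ ‖ζ‖ ^ (1 / 2 : ℝ) := by
    refine Asymptotics.IsBigO.trans ?_ (rpow_isBigO_atInfty (a := 0) (by norm_num))
    simp only [Real.rpow_zero]
    exact Asymptotics.isBigO_const_const _ one_ne_zero _
  refine (h2.add h1).congr' ?_ EventuallyEq.rfl
  filter_upwards [eventually_atInfty 1] with ζ hζ
  rw [symB_two_eq hζ.1, ← map_smul, ← map_add, pow_zero, one_mul]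

end bounds

/-! ### Transfer to the weighted Sobolev spaces -/

theorem toL2_surjective (n : ℕ) (s σ : ℝ) : Function.Surjective (toL2 n s σ) := by
  intro f
  have key : weight n σ (japaneseNabla n s (japaneseNabla n (-s)
      (weight n (-σ) (Lp.toTemperedDistributionCLM ℂ volume 2 f)))) =
      Lp.toTemperedDistributionCLM ℂ volume 2 f := by
    have h1 := japaneseNabla_neg_japaneseNabla n (-s)
      (weight n (-σ) (Lp.toTemperedDistributionCLM ℂ volume 2 f))
    have h2 := weight_neg_weight n (-σ) (Lp.toTemperedDistributionCLM ℂ volume 2 f)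
    rw [neg_neg] at h1 h2
    rw [h1, h2]
  let ψ : H n s σ := (⟨_, mem_Hs_iff.mpr ⟨f, key.symm⟩⟩ : Hs n s σ)
  exact ⟨ψ, toTempered_injective n ((toL2_spec ψ).trans key)⟩

/-- The isometry `ψ ↦ ⟨x⟩^σ ⟨∇⟩^s ψ` of `H^s_σ` onto `L²`. -/
def equivL2 (n : ℕ) (s σ : ℝ) : H n s σ ≃ₗᵢ[ℂ] L2n n where
  __ := LinearEquiv.ofBijective (toL2 n s σ) ⟨toL2_injective n s σ, toL2_surjective n s σ⟩
  norm_map' _ := rfl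

/-- An operator on `L²`, transported to the weighted Sobolev spaces. -/
def transport (n : ℕ) (s σ s' σ' : ℝ) :
    (L2n n →L[ℂ] L2n n) →L[ℂ] (H n s σ →L[ℂ] H n s' σ') :=
  LinearMap.mkContinuous
    { toFun := fun A ↦ ((equivL2 n s' σ').symm : L2n n →L[ℂ] H n s' σ') ∘L A ∘L
        (equivL2 n s σ : H n s σ →L[ℂ] L2n n)
      map_add' := fun A B ↦ by
        ext1 u
        simp
      map_smul' := fun c A ↦ by
        ext1 u
        simp } 1 fun A ↦ by
    refine ContinuousLinearMap.opNorm_le_bound _ (by positivity) fun u ↦ ?_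
    simpa using A.le_opNorm (equivL2 n s σ u)

theorem toL2_transport {s σ s' σ' : ℝ} (A : L2n n →L[ℂ] L2n n) (u : H n s σ) :
    toL2 n s' σ' (transport n s σ s' σ' A u) = A (toL2 n s σ u) :=
  (equivL2 n s' σ').apply_symm_apply _

theorem freeResolvent_eq_fourierMultiplier {ζ : ℂ} (hζ : ζ ∈ slit) :
    freeResolvent n ζ = TemperedDistribution.fourierMultiplierCLM ℂ
      (fun ξ : Rn n ↦ (((2 * π) ^ 2 * ‖ξ‖ ^ 2 : ℝ) - ζ : ℂ)⁻¹) := by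
  ext1 u
  have hsym : (fun ξ : Rn n ↦ (((2 * π) ^ 2 * ‖ξ‖ ^ 2 : ℝ) - ζ : ℂ)).HasTemperateGrowth := by
    fun_prop
  have hone : ((fun ξ : Rn n ↦ (((2 * π) ^ 2 * ‖ξ‖ ^ 2 : ℝ) - ζ : ℂ)⁻¹) *
      fun ξ : Rn n ↦ (((2 * π) ^ 2 * ‖ξ‖ ^ 2 : ℝ) - ζ : ℂ)) = fun _ ↦ (1 : ℂ) := by
    ext ξ
    exact inv_mul_cancel₀ (symbol_ne_zero hζ ξ)
  conv_rhs => rw [← freeResolvent_schrodinger n hζ (TemperedDistribution.fourierMultiplierCLM ℂ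
      (fun ξ : Rn n ↦ (((2 * π) ^ 2 * ‖ξ‖ ^ 2 : ℝ) - ζ : ℂ)⁻¹) u)]
  rw [schrodinger_eq_fourierMultiplier,
    TemperedDistribution.fourierMultiplierCLM_fourierMultiplierCLM_apply
      (hasTemperateGrowth_inv_symbol n hζ) hsym, hone]
  simp

/-- Undoing the isometries cancels both weights and leaves the multiplier with symbol P^s · P^l Q ·
P^{-(s+l)} = Q. -/
theorem toDist_transport_sandwich {s σ l : ℝ} (hσ : 0 ≤ σ) (hl : l ≤ 2) {ζ : ℂ} (hζ : ζ ∈ slit)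
    (u : H n s σ) :
    toDist n (s + l) (-σ) (transport n s σ (s + l) (-σ) (sandwich n hσ (symB n l ζ)) u) =
      freeResolvent n ζ (toDist n s σ u) := by
  set v := transport n s σ (s + l) (-σ) (sandwich n hσ (symB n l ζ)) u with hv
  have hm : (⇑(symB n l ζ)).HasTemperateGrowth := by
    rw [symB_coe hl hζ]
    exact hasTemperateGrowth_resSymbol l hζ
  have hw : TemperedDistribution.smulLeftCLM ℂ (rho n hσ) = weight n (-σ) := by
    rw [rho_coe]
    rfl
  have h := toL2_spec v
  rw [hv, toL2_transport, sandwich_apply, toTempered_bmul _ (hasTemperateGrowth_rho hσ),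
    toTempered_fmul _ hm, toTempered_bmul _ (hasTemperateGrowth_rho hσ), hw, toL2_spec,
    weight_neg_weight, ← hv] at h
  have h1 := congrArg (weight n (- -σ)) h
  rw [weight_neg_weight, weight_neg_weight] at h1
  rw [← japaneseNabla_neg_japaneseNabla n (s + l) (toDist n (s + l) (-σ) v), ← h1,
    symB_coe hl hζ, freeResolvent_eq_fourierMultiplier hζ, japaneseNabla, japaneseNabla,
    TemperedDistribution.fourierMultiplierCLM_fourierMultiplierCLM_apply
      (hasTemperateGrowth_japanese n _) (hasTemperateGrowth_resSymbol l hζ),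
    TemperedDistribution.fourierMultiplierCLM_fourierMultiplierCLM_apply
      ((hasTemperateGrowth_japanese n _).mul (hasTemperateGrowth_resSymbol l hζ))
      (hasTemperateGrowth_japanese n _)]
  congr 2
  ext ξ
  change (japF n s ξ : ℂ) * resSymbol n l ζ ξ * (japF n (-(s + l)) ξ : ℂ) = _
  rw [resSymbol]
  have h3 : japF n s ξ * japF n l ξ * japF n (-(s + l)) ξ = 1 := by
    rw [← japF_add, ← japF_add, add_neg_cancel]
    exact jap_zero _
  have h4 : (japF n s ξ : ℂ) * japF n l ξ * japF n (-(s + l)) ξ = 1 := by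
    exact_mod_cast h3
  linear_combination (((2 * π) ^ 2 * ‖ξ‖ ^ 2 : ℝ) - ζ : ℂ)⁻¹ * h4

theorem sandwich_pow_mul_symB_isBigO {σ : ℝ} (hσ : 0 ≤ σ) (k : ℕ) (hk : 1 / 2 + (k : ℝ) < σ) (l : ℤ)
    (hl : (k = 0 ∧ l ∈ ({-1, 0, 1, 2} : Set ℤ)) ∨ (1 ≤ k ∧ l ∈ ({-1, 0, 1} : Set ℤ))) :
    (fun ζ ↦ sandwich n hσ (symB n 0 ζ ^ k * symB n (l : ℝ) ζ)) =O[atInfty]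
      fun ζ ↦ ‖ζ‖ ^ (-((1 - (l : ℝ) + k) / 2)) := by
  have hl' : l = -1 ∨ l = 0 ∨ l = 1 ∨ l = 2 ∧ k = 0 := by
    simp only [Set.mem_insert_iff, Set.mem_singleton_iff] at hl
    omega
  rcases hl' with rfl | rfl | rfl | ⟨rfl, rfl⟩
  · have h := sandwich_pow_mul_symB_neg_one (n := n) hσ k hk
    norm_num at h ⊢
    exact h
  · have h := sandwich_pow_mul_symB_zero (n := n) hσ k hk
    simpa using h
  · have h := sandwich_pow_mul_symB_one (n := n) hσ k hk
    simpa using h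
  · have h := sandwich_symB_two (n := n) hσ (by simpa using hk)
    refine (h.congr_left fun ζ ↦ ?_).congr_right fun ζ ↦ ?_
    · norm_num
    · norm_num

end WeightedSobolev
end

/-! ### The main theorem -/

theorem propositionA1 (n : ℕ) (hn : 1 ≤ n) (k : ℕ) (s σ : ℝ) (hσ : 1 / 2 + (k : ℝ) < σ) (l : ℤ)
    (hl : (k = 0 ∧ l ∈ ({-1, 0, 1, 2} : Set ℤ)) ∨ (1 ≤ k ∧ l ∈ ({-1, 0, 1} : Set ℤ))) :
    ∃ R : ℂ → (WeightedSobolev.H n s σ →L[ℂ] WeightedSobolev.H n (s + (l : ℝ)) (-σ)),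
      (∀ ζ ∈ WeightedSobolev.slit, ∀ u : WeightedSobolev.H n s σ,
        WeightedSobolev.toDist n (s + (l : ℝ)) (-σ) (R ζ u) =
          WeightedSobolev.freeResolvent n ζ (WeightedSobolev.toDist n s σ u)) ∧
      AnalyticOnNhd ℂ R WeightedSobolev.slit ∧
      (fun ζ : ℂ ↦ ‖iteratedDeriv k R ζ‖)
        =O[Bornology.cobounded ℂ ⊓ 𝓟 WeightedSobolev.slit]
        (fun ζ : ℂ ↦ ‖ζ‖ ^ (-((1 - (l : ℝ) + (k : ℝ)) / 2))) := by
  have hσ0 : 0 ≤ σ := by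
    have : (0 : ℝ) ≤ k := k.cast_nonneg
    linarith
  have hl2 : (l : ℝ) ≤ 2 := by
    have : l ≤ 2 := by
      simp only [Set.mem_insert_iff, Set.mem_singleton_iff] at hl
      omega
    exact_mod_cast this
  let T := WeightedSobolev.transport n s σ (s + (l : ℝ)) (-σ)
  -- A continuous linear map from symbols to operators: analyticity and the formula for derivatives
  -- pass from the symbol to the resolvent.
  let Ψ := T ∘L WeightedSobolev.sandwich n hσ0
  refine ⟨fun ζ ↦ Ψ (WeightedSobolev.symB n (l : ℝ) ζ), fun ζ hζ u ↦
    WeightedSobolev.toDist_transport_sandwich hσ0 hl2 hζ u,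
    Ψ.comp_analyticOnNhd (WeightedSobolev.analyticOnNhd_symB hl2), ?_⟩
  -- The factor k! is the one in the k-th derivative k! Ψ(Q^k P^l Q).
  have h := ((T.isBigO_comp _ _).trans
    (WeightedSobolev.sandwich_pow_mul_symB_isBigO (n := n) hσ0 k hσ l hl)).const_smul_left
      (k.factorial : ℂ)
  refine (h.congr' ?_ EventuallyEq.rfl).norm_left
  filter_upwards [WeightedSobolev.eventually_atInfty 0] with ζ hζ
  exact (WeightedSobolev.iteratedDeriv_comp_symB Ψ hl2 k ζ hζ.1).symm
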